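/- Work in many-sorted first-order logic with equality, with non-empty domains and infinitely many variables of each sort. Let $\Sigma_f$ be the signature with one sort $\sigma_1$, one function symbol $f:\sigma_1\to\sigma_1$ and no predicate symbols other than equality, and let $\Sigma_f^2$ be the same signature with a second sort $\sigma_2$ added. For $n\ge 1$ let $\mathrm{cycle}_n(x)$ be the formula $f^n(x)=x\wedge\bigwedge_{m\mid n,\,m\ne n} f^m(x)\neq x$. Let $S$ be a set of primes that are at least $7$, and suppose that $S$ is undecidable (such sets exist). Let $T_1,\dots,T_4$ be the $\Sigma_f$-theories with the axioms - $\mathrm{Ax}(T_1)=\{(\exists x\,\mathrm{cycle}_n(x))\to\forall x\, f^2(x)\neq x \mid n\in S\}$, - $\mathrm{Ax}(T_2)=\mathrm{Ax}(T_1)\cup\{\neg\exists x\,\mathrm{cycle}_6(x)\}$, - $\mathrm{Ax}(T_3)=\mathrm{Ax}(T_1)\cup\{(\exists x\, f(x)=x)\to\forall x\forall y\; x=y\}$, - $\mathrm{Ax}(T_4)=\mathrm{Ax}(T_2)\cup\mathrm{Ax}(T_3)$, and let $\mathrm{adds}(T_i)$ be the $\Sigma_f^2$-theory with the same axioms as $T_i$.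 Definitions, for a theory $T$ and with respect to the set of all sorts $\sigma$ of its signature (finite here): - A *witness* is a computable map $\mathrm{wit}$ from quantifier-free formulas to quantifier-free formulas such that, for every quantifier-free $\varphi$: (i) $\varphi$ is $T$-equivalent to $\exists \vec x\,\mathrm{wit}(\varphi)$, where $\vec x$ lists the variables of $\mathrm{wit}(\varphi)$ that are not in $\varphi$; (ii) if $\mathrm{wit}(\varphi)$ is $T$-satisfiable, then there is a $T$-interpretation $\mathcal A\models\varphi$ in which every element of every domain is the value of a variable of $\mathrm{wit}(\varphi)$ of that sort. It is a *strong witness* if moreover, for every quantifier-free $\varphi$, finite set $V$ of variables and arrangement $\delta_V$ (the conjunction of all $x=y$ with $xEy$ and all $\neg(x=y)$ with not $xEy$, for $x,y\in V$ of the same sort, where $E$ is an equivalence relation on $V$ that relates only variables of equal sort), if $\mathrm{wit}(\varphi)\wedge\delta_V$ is $T$-satisfiable, then it is satisfied by a $T$-interpretation in which every element of every domain is the value of a variable of $\mathrm{wit}(\varphi)\wedge\delta_V$ of that sort. $T$ is *strongly finitely witnessable* if it has a strong witness. - A *minimal model function* maps each quantifier-free formula $\varphi$ to a set $\mathrm{MM}(\varphi)$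 of functions from the sorts to the cardinals such that, if $\varphi$ is $T$-satisfiable: each $\mathbf n\in\mathrm{MM}(\varphi)$ is the function $\sigma\mapsto|\sigma^{\mathcal A}|$ of some $T$-interpretation $\mathcal A\models\varphi$; for distinct $\mathbf m,\mathbf n\in\mathrm{MM}(\varphi)$ there is a sort $\sigma$ with $\mathbf m(\sigma)<\mathbf n(\sigma)$; and for every $T$-interpretation $\mathcal A\models\varphi$ there is $\mathbf n\in\mathrm{MM}(\varphi)$ with $\mathbf n(\sigma)\le|\sigma^{\mathcal A}|$ for all $\sigma$. On formulas that are not $T$-satisfiable its value is arbitrary. It is *computable* if all $\mathrm{MM}(\varphi)$ are finite sets of functions into $\mathbb N\cup\{\aleph_0\}$ and an algorithm lists $\mathrm{MM}(\varphi)$ on every input $\varphi$. - $T$ is a *Unicorn 2.0 theory* if it is strongly finitely witnessable and has no computable minimal model function. - $T$ is *stably infinite* if every $T$-satisfiable quantifier-free formula is satisfied by a $T$-interpretation all of whose domains are infinite. - $T$ is *convex* if, whenever $\varphi$ is a conjunction of literals, $k\ge1$ and $x_i,y_i$ are variables of equal sort such that $\varphi\to\bigvee_{i=1}^k x_i=y_i$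 is $T$-valid, then $\varphi\to x_i=y_i$ is $T$-valid for some $i$. **Theorem.** For each $i\in\{1,2,3,4\}$, both $T_i$ and $\mathrm{adds}(T_i)$ are strongly finitely witnessable and have no computable minimal model function, i.e. they are Unicorn 2.0 theories. Both are stably infinite if $i\in\{1,2\}$ and both are not stably infinite if $i\in\{3,4\}$; both are convex if $i\in\{1,3\}$ and both are not convex if $i\in\{2,4\}$. Consequently, for each of the eight combinations of one-sorted or many-sorted, stably infinite or not, and convex or not, there is a Unicorn 2.0 theory over a finite non-empty signature (one with at least one function or predicate symbol other than equality) that realizes it. -/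

import Mathlib

/-! Many-sorted first-order logic with equality, properties used in theory combination,
and the theories `T1`, ..., `T4` together with their two-sorted versions. -/

universe u

namespace ManySorted

open Cardinal

/-- A many-sorted signature. The equality symbols are logical symbols and are not listed among
`Preds`. Sorts and symbols carry a fixed numbering, so that formulas can be coded by numbers
(signatures are thus countable; the numbering is immaterial for finite signatures). -/
structure Signature where
  Sorts : Type
  Funcs : Type
  Preds : Type
  /-- number of arguments of a function symbol -/
  funcArity : Funcs → ℕ
  /-- sorts of the arguments of a function symbol -/
  funcDom : (f : Funcs) → Fin (funcArity f) → Sorts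
  /-- sort of the value of a function symbol -/
  funcCod : Funcs → Sorts
  /-- number of arguments of a predicate symbol -/
  predArity : Preds → ℕ
  /-- sorts of the arguments of a predicate symbol -/
  predDom : (P : Preds) → Fin (predArity P) → Sorts
  nonempty_sorts : Nonempty Sorts
  encSorts : Encodable Sorts
  encFuncs : Encodable Funcs
  encPreds : Encodable Preds

/-- A variable is a sort with an index; each sort has infinitely many variables. -/
abbrev Var (Sg : Signature) : Type := Sg.Sorts × ℕ

/-- Terms of a given sort. -/
inductive Term (Sg : Signature) : Sg.Sorts → Type
  | var (s : Sg.Sorts) (n : ℕ) : Term Sg s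
  | app (f : Sg.Funcs) (args : (i : Fin (Sg.funcArity f)) → Term Sg (Sg.funcDom f i)) :
      Term Sg (Sg.funcCod f)

/-- First-order formulas. -/
inductive Formula (Sg : Signature) : Type
  | bot : Formula Sg
  | equal (s : Sg.Sorts) (t t' : Term Sg s) : Formula Sg
  | rel (P : Sg.Preds) (args : (i : Fin (Sg.predArity P)) → Term Sg (Sg.predDom P i)) : Formula Sg
  | neg (φ : Formula Sg) : Formula Sg
  | conj (φ ψ : Formula Sg) : Formula Sg
  | disj (φ ψ : Formula Sg) : Formula Sg
  | all (x : Var Sg) (φ : Formula Sg) : Formula Sg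
  | ex (x : Var Sg) (φ : Formula Sg) : Formula Sg

variable {Sg : Signature}

/-! ### Formulas: basic notions -/

/-- The variables of a term. -/
def Term.vars : {s : Sg.Sorts} → Term Sg s → Set (Var Sg)
  | _, .var s n => {(s, n)}
  | _, .app _ args => ⋃ i, (args i).vars

namespace Formula

/-- The free variables of a formula. -/
def freeVars : Formula Sg → Set (Var Sg)
  | bot => ∅
  | equal _ t t' => t.vars ∪ t'.vars
  | rel _ args => ⋃ i, (args i).vars
  | neg φ => φ.freeVars
  | conj φ ψ => φ.freeVars ∪ ψ.freeVars
  | disj φ ψ => φ.freeVars ∪ ψ.freeVars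
  | all x φ => φ.freeVars \ {x}
  | ex x φ => φ.freeVars \ {x}

/-- Quantifier-free formulas. -/
def IsQF : Formula Sg → Prop
  | bot => True
  | equal _ _ _ => True
  | rel _ _ => True
  | neg φ => φ.IsQF
  | conj φ ψ => φ.IsQF ∧ ψ.IsQF
  | disj φ ψ => φ.IsQF ∧ ψ.IsQF
  | all _ _ => False
  | ex _ _ => False

/-- Atomic formulas: equations and predicates applied to terms. -/
def IsAtomic : Formula Sg → Prop
  | equal _ _ _ => True
  | rel _ _ => True
  | _ => False

/-- Literals: atomic formulas and their negations. -/
def IsLiteral : Formula Sg → Prop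
  | neg φ => φ.IsAtomic
  | φ => φ.IsAtomic

def top : Formula Sg := neg bot

def imp (φ ψ : Formula Sg) : Formula Sg := disj (neg φ) ψ

/-- Finite conjunction; the empty one is `top`. -/
def bigConj : List (Formula Sg) → Formula Sg
  | [] => top
  | φ :: l => conj φ (bigConj l)

/-- Finite disjunction; the empty one is `bot`. -/
def bigDisj : List (Formula Sg) → Formula Sg
  | [] => bot
  | φ :: l => disj φ (bigDisj l)

/-- The equation between the variables with indices `m` and `n` of sort `s`. -/
def varEq (s : Sg.Sorts) (m n : ℕ) : Formula Sg := equal s (.var s m) (.var s n)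

end Formula

/-- The quantifier-free formulas over a signature. -/
abbrev QF (Sg : Signature) : Type := {φ : Formula Sg // φ.IsQF}

/-! ### Gödel numbering and computable functions on quantifier-free formulas -/

def Signature.sortCode (Sg : Signature) : Sg.Sorts → ℕ := Sg.encSorts.encode
def Signature.funcCode (Sg : Signature) : Sg.Funcs → ℕ := Sg.encFuncs.encode
def Signature.predCode (Sg : Signature) : Sg.Preds → ℕ := Sg.encPreds.encode

/-- Gödel number of a term. -/
def Term.code : {s : Sg.Sorts} → Term Sg s → ℕ
  | _, .var s n => Nat.pair 0 (Nat.pair (Sg.sortCode s) n)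
  | _, .app f args =>
      Nat.pair 1 (Nat.pair (Sg.funcCode f) (Encodable.encode (List.ofFn fun i => (args i).code)))

/-- Gödel number of a formula. -/
def Formula.code : Formula Sg → ℕ
  | .bot => Nat.pair 0 0
  | .equal s t t' => Nat.pair 1 (Nat.pair (Sg.sortCode s) (Nat.pair t.code t'.code))
  | .rel P args =>
      Nat.pair 2 (Nat.pair (Sg.predCode P) (Encodable.encode (List.ofFn fun i => (args i).code)))
  | .neg φ => Nat.pair 3 φ.code
  | .conj φ ψ => Nat.pair 4 (Nat.pair φ.code ψ.code)
  | .disj φ ψ => Nat.pair 5 (Nat.pair φ.code ψ.code)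
  | .all x φ => Nat.pair 6 (Nat.pair (Nat.pair (Sg.sortCode x.1) x.2) φ.code)
  | .ex x φ => Nat.pair 7 (Nat.pair (Nat.pair (Sg.sortCode x.1) x.2) φ.code)

/-- A function on quantifier-free formulas is computable if it is computable on Gödel numbers. -/
def ComputableOnQF (F : QF Sg → QF Sg) : Prop :=
  ∃ g : ℕ → ℕ, Computable g ∧ ∀ φ : QF Sg, g φ.1.code = (F φ).1.code

/-! ### Interpretations and theories -/

/-- A structure: non-empty domains and interpretations of the symbols. -/
structure Struc (Sg : Signature) where
  dom : Sg.Sorts → Type u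
  nonempty_dom : ∀ s, Nonempty (dom s)
  func : (f : Sg.Funcs) → ((i : Fin (Sg.funcArity f)) → dom (Sg.funcDom f i)) → dom (Sg.funcCod f)
  pred : (P : Sg.Preds) → ((i : Fin (Sg.predArity P)) → dom (Sg.predDom P i)) → Prop

/-- The value of a term under an assignment `v` of the variables. -/
def Term.eval (M : Struc.{u} Sg) (v : (s : Sg.Sorts) → ℕ → M.dom s) :
    {s : Sg.Sorts} → Term Sg s → M.dom s
  | _, .var s n => v s n
  | _, .app f args => M.func f fun i => (args i).eval M v

/-- Satisfaction. A quantifier over `x` ranges over the assignments that differ from `v` at most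
at `x`. -/
def Formula.Holds (M : Struc.{u} Sg) :
    Formula Sg → ((s : Sg.Sorts) → ℕ → M.dom s) → Prop
  | .bot, _ => False
  | .equal _ t t', v => t.eval M v = t'.eval M v
  | .rel P args, v => M.pred P fun i => (args i).eval M v
  | .neg φ, v => ¬ φ.Holds M v
  | .conj φ ψ, v => φ.Holds M v ∧ ψ.Holds M v
  | .disj φ ψ, v => φ.Holds M v ∨ ψ.Holds M v
  | .all x φ, v => ∀ w : (s : Sg.Sorts) → ℕ → M.dom s,
      (∀ s n, (s, n) ≠ x → w s n = v s n) → φ.Holds M w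
  | .ex x φ, v => ∃ w : (s : Sg.Sorts) → ℕ → M.dom s,
      (∀ s n, (s, n) ≠ x → w s n = v s n) ∧ φ.Holds M w

/-- An interpretation: a structure with an assignment of the variables. -/
structure Interp (Sg : Signature) extends Struc.{u} Sg where
  val : (s : Sg.Sorts) → ℕ → dom s

namespace Interp

def Sat (A : Interp.{u} Sg) (φ : Formula Sg) : Prop := φ.Holds A.toStruc A.val

/-- `A` satisfies the formula obtained from `φ` by existentially quantifying all variables
in `X`. -/
def SatEx (A : Interp.{u} Sg) (X : Set (Var Sg)) (φ : Formula Sg) : Prop :=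
  ∃ w : (s : Sg.Sorts) → ℕ → A.dom s,
    (∀ s n, (s, n) ∉ X → w s n = A.val s n) ∧ φ.Holds A.toStruc w

/-- The domain of `s` in `A` consists of the values of the variables of sort `s` that are free
in `φ`. -/
def CoveredBy (A : Interp.{u} Sg) (φ : Formula Sg) (s : Sg.Sorts) : Prop :=
  (Set.univ : Set (A.dom s)) = A.val s '' {n | (s, n) ∈ φ.freeVars}

end Interp

/-- A theory, given by a set of sentences that axiomatizes it. -/
structure Theory (Sg : Signature) where
  ax : Set (Formula Sg)
  sentences : ∀ φ ∈ ax, φ.freeVars = ∅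

namespace Theory

variable (T : Theory Sg)

/-- `A` is a `T`-interpretation. -/
def IsInterp (A : Interp.{u} Sg) : Prop := ∀ φ ∈ T.ax, A.Sat φ

def Satisfiable (φ : Formula Sg) : Prop := ∃ A : Interp.{u} Sg, T.IsInterp A ∧ A.Sat φ

def Valid (φ : Formula Sg) : Prop := ∀ A : Interp.{u} Sg, T.IsInterp A → A.Sat φ

/-! ### Properties of theories, with respect to a set `S` of sorts -/

def StablyInfinite (S : Set Sg.Sorts) : Prop :=
  ∀ φ : QF Sg, Satisfiable.{u} T φ.1 →
    ∃ A : Interp.{u} Sg, T.IsInterp A ∧ A.Sat φ.1 ∧ ∀ s ∈ S, ℵ₀ ≤ #(A.dom s)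

/-- Convexity: if a conjunction of literals entails, modulo `T`, a non-empty disjunction of
equations between variables whose sorts are in `S`, then it entails one of them. -/
def Convex (S : Set Sg.Sorts) : Prop :=
  ∀ L : List (Formula Sg), (∀ l ∈ L, l.IsLiteral) →
    ∀ (k : ℕ) (s : Fin k → Sg.Sorts) (x y : Fin k → ℕ), 0 < k → (∀ i, s i ∈ S) →
      Valid.{u} T ((Formula.bigConj L).imp
        (Formula.bigDisj (List.ofFn fun i => Formula.varEq (s i) (x i) (y i)))) →
      ∃ i, Valid.{u} T ((Formula.bigConj L).imp (Formula.varEq (s i) (x i) (y i)))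

end Theory

open Classical in
/-- The arrangement on `V` induced by an equivalence relation `E` on `V`: the conjunction of
`x = y` for all `x`, `y` in `V` with `E x y`, and of `¬ x = y` for all `x`, `y` in `V` of the same
sort without `E x y`. -/
noncomputable def arrangement (V : Finset (Var Sg)) (E : Setoid V) : Formula Sg :=
  Formula.bigConj
    (((Finset.univ : Finset (V × V)).filter fun p => p.1.1.1 = p.2.1.1).toList.map fun p =>
      if E p.1 p.2 then Formula.varEq p.1.1.1 p.1.1.2 p.2.1.2
      else Formula.neg (Formula.varEq p.1.1.1 p.1.1.2 p.2.1.2))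

namespace Theory

variable (T : Theory Sg)

/-- `wit` is a witness. -/
def IsWitness (S : Set Sg.Sorts) (wit : QF Sg → QF Sg) : Prop :=
  ComputableOnQF wit ∧
  (∀ φ : QF Sg, ∀ A : Interp.{u} Sg, T.IsInterp A →
    (A.Sat φ.1 ↔ A.SatEx ((wit φ).1.freeVars \ φ.1.freeVars) (wit φ).1)) ∧
  (∀ φ : QF Sg, Satisfiable.{u} T (wit φ).1 →
    ∃ A : Interp.{u} Sg, T.IsInterp A ∧ A.Sat φ.1 ∧ ∀ s ∈ S, A.CoveredBy (wit φ).1 s)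

/-- `wit` is a strong witness. -/
def IsStrongWitness (S : Set Sg.Sorts) (wit : QF Sg → QF Sg) : Prop :=
  IsWitness.{u} T S wit ∧
  ∀ (φ : QF Sg) (V : Finset (Var Sg)) (E : Setoid V),
    (∀ x ∈ V, x.1 ∈ S) → (∀ x y : V, E x y → x.1.1 = y.1.1) →
    Satisfiable.{u} T ((wit φ).1.conj (arrangement V E)) →
    ∃ A : Interp.{u} Sg, T.IsInterp A ∧ A.Sat ((wit φ).1.conj (arrangement V E)) ∧
      ∀ s ∈ S, A.CoveredBy ((wit φ).1.conj (arrangement V E)) s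

def StronglyFinitelyWitnessable (S : Set Sg.Sorts) : Prop :=
  ∃ wit : QF Sg → QF Sg, IsStrongWitness.{u} T S wit

/-- `MM` is a minimal model function. Its values on formulas that are not `T`-satisfiable are
arbitrary. -/
def IsMinimalModelFunction (S : Set Sg.Sorts) (MM : QF Sg → Set (S → Cardinal.{u})) : Prop :=
  ∀ φ : QF Sg, Satisfiable.{u} T φ.1 →
    (∀ n ∈ MM φ, ∃ A : Interp.{u} Sg, T.IsInterp A ∧ A.Sat φ.1 ∧ ∀ s : S, n s = #(A.dom s)) ∧
    (∀ m ∈ MM φ, ∀ n ∈ MM φ, m ≠ n → ∃ s : S, m s < n s) ∧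
    (∀ A : Interp.{u} Sg, T.IsInterp A → A.Sat φ.1 →
      ∃ n ∈ MM φ, ∀ s : S, n s ≤ #(A.dom s))

end Theory

/-- The cardinal in `ℕ ∪ {ℵ₀}` presented by an element of `Option ℕ`. -/
def cardOf : Option ℕ → Cardinal.{u}
  | some n => n
  | none => ℵ₀

/-- The function from `S` to `ℕ ∪ {ℵ₀}` presented by a list: the entry at position
`Sg.sortCode s` is the value at `s`. For finite `S`, every such function is presented. -/
def cardFunOf (S : Set Sg.Sorts) (l : List (Option ℕ)) : S → Cardinal.{u} :=
  fun s => cardOf (l.getD (Sg.sortCode s) none)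

namespace Theory

variable (T : Theory Sg)

/-- `T` has a computable minimal model function: some algorithm lists, on every quantifier-free
formula, the (finitely many, countable) values of a minimal model function. -/
def HasComputableMinimalModelFunction (S : Set Sg.Sorts) : Prop :=
  ∃ MM : QF Sg → Set (S → Cardinal.{u}), IsMinimalModelFunction.{u} T S MM ∧
    ∃ g : ℕ → List (List (Option ℕ)), Computable g ∧
      ∀ φ : QF Sg, MM φ = {n | ∃ l ∈ g φ.1.code, n = cardFunOf S l}

/-- Unicorn 2.0 theories. -/
def IsUnicorn2 (S : Set Sg.Sorts) : Prop :=
  StronglyFinitelyWitnessable.{u} T S ∧ ¬ HasComputableMinimalModelFunction.{u} T S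

end Theory

/-! ### The signatures with one unary function symbol -/

/-- One sort `0`, one function symbol of arity `0 → 0`, no predicate symbols. -/
@[reducible] def sigF : Signature where
  Sorts := Fin 1
  Funcs := Unit
  Preds := Empty
  funcArity _ := 1
  funcDom _ _ := 0
  funcCod _ := 0
  predArity _ := 0
  predDom _ _ := 0
  nonempty_sorts := inferInstance
  encSorts := inferInstance
  encFuncs := inferInstance
  encPreds := inferInstance

/-- Two sorts `0` and `1`, one function symbol of arity `0 → 0`, no predicate symbols. -/
@[reducible] def sigF2 : Signature where
  Sorts := Fin 2
  Funcs := Unit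
  Preds := Empty
  funcArity _ := 1
  funcDom _ _ := 0
  funcCod _ := 0
  predArity _ := 0
  predDom _ _ := 0
  nonempty_sorts := inferInstance
  encSorts := inferInstance
  encFuncs := inferInstance
  encPreds := inferInstance

/-- The term `f ^ n (x)`, where `x` is the variable with index `x`. -/
def fpow : ℕ → ℕ → Term sigF (0 : Fin 1)
  | 0, x => Term.var (Sg := sigF) (0 : Fin 1) x
  | n + 1, x => Term.app (Sg := sigF) () fun _ => fpow n x

/-- The formula `f ^ n (x) = x`. -/
def fpowEq (n x : ℕ) : Formula sigF := .equal (0 : Fin 1) (fpow n x) (Term.var (Sg := sigF) (0 : Fin 1) x)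

/-- For `n > 0`: `x` lies on a cycle of length `n`, that is, `f ^ n (x) = x`, and `f ^ m (x) ≠ x`
for all divisors `m ≠ n` of `n`. -/
def cycle (n x : ℕ) : Formula sigF :=
  (fpowEq n x).conj
    (Formula.bigConj (((List.range n).filter (· ∣ n)).map fun m => (fpowEq m x).neg))

/-- The axioms `(∃ x, cycle n x) → ∀ x, f² (x) ≠ x` for `n ∈ S`. -/
def ax1 (S : Set ℕ) : Set (Formula sigF) :=
  {φ | ∃ n ∈ S, φ = (Formula.ex (Sg := sigF) ((0 : Fin 1), 0) (cycle n 0)).imp (.all ((0 : Fin 1), 0) (fpowEq 2 0).neg)}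

/-- In addition, `¬ ∃ x, cycle 6 x`. -/
def ax2 (S : Set ℕ) : Set (Formula sigF) :=
  ax1 S ∪ {(Formula.ex (Sg := sigF) ((0 : Fin 1), 0) (cycle 6 0)).neg}

/-- In addition to `ax1`, `(∃ x, f (x) = x) → ∀ x, ∀ y, x = y`. -/
def ax3 (S : Set ℕ) : Set (Formula sigF) :=
  ax1 S ∪ {(Formula.ex (Sg := sigF) ((0 : Fin 1), 0) (fpowEq 1 0)).imp
    (.all ((0 : Fin 1), 0) (.all ((0 : Fin 1), 1) (Formula.varEq (0 : Fin 1) 0 1)))}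

def ax4 (S : Set ℕ) : Set (Formula sigF) := ax2 S ∪ ax3 S

theorem vars_fpow (n x : ℕ) : (fpow n x).vars = {((0 : Fin 1), x)} := by
  induction n with
  | zero => rfl
  | succ n ih => simp [fpow, Term.vars, ih]

theorem freeVars_fpowEq (n x : ℕ) : (fpowEq n x).freeVars = {((0 : Fin 1), x)} := by
  simp [fpowEq, Formula.freeVars, vars_fpow, Term.vars]

theorem freeVars_bigConj_subset (X : Set (Var Sg)) (l : List (Formula Sg))
    (h : ∀ φ ∈ l, φ.freeVars ⊆ X) : (Formula.bigConj l).freeVars ⊆ X := by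
  induction l with
  | nil => simp [Formula.bigConj, Formula.top, Formula.freeVars]
  | cons φ l ih =>
    simp only [List.mem_cons, forall_eq_or_imp] at h
    exact Set.union_subset h.1 (ih h.2)

theorem freeVars_cycle (n x : ℕ) : (cycle n x).freeVars ⊆ {((0 : Fin 1), x)} := by
  refine Set.union_subset (freeVars_fpowEq n x).le (freeVars_bigConj_subset _ _ ?_)
  intro φ hφ
  obtain ⟨m, -, rfl⟩ := List.mem_map.1 hφ
  exact (freeVars_fpowEq m x).le

theorem sentences_ax1 (S : Set ℕ) : ∀ φ ∈ ax1 S, φ.freeVars = ∅ := by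
  rintro φ ⟨n, -, rfl⟩
  simp only [Formula.imp, Formula.freeVars, freeVars_fpowEq, Set.sdiff_self, Set.union_empty]
  exact Set.sdiff_eq_empty.2 (freeVars_cycle n 0)

theorem sentences_ax2 (S : Set ℕ) : ∀ φ ∈ ax2 S, φ.freeVars = ∅ := by
  rintro φ (h | rfl)
  · exact sentences_ax1 S φ h
  · exact Set.sdiff_eq_empty.2 (freeVars_cycle 6 0)

theorem sentences_ax3 (S : Set ℕ) : ∀ φ ∈ ax3 S, φ.freeVars = ∅ := by
  rintro φ (h | rfl)
  · exact sentences_ax1 S φ h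
  · ext ⟨s, n⟩
    simp [Formula.imp, Formula.freeVars, freeVars_fpowEq, Formula.varEq, Term.vars]

theorem sentences_ax4 (S : Set ℕ) : ∀ φ ∈ ax4 S, φ.freeVars = ∅ := by
  rintro φ (h | h)
  · exact sentences_ax2 S φ h
  · exact sentences_ax3 S φ h

def T1 (S : Set ℕ) : Theory sigF := ⟨ax1 S, sentences_ax1 S⟩
def T2 (S : Set ℕ) : Theory sigF := ⟨ax2 S, sentences_ax2 S⟩
def T3 (S : Set ℕ) : Theory sigF := ⟨ax3 S, sentences_ax3 S⟩
def T4 (S : Set ℕ) : Theory sigF := ⟨ax4 S, sentences_ax4 S⟩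

/-! ### Adding a sort -/

/-- A term over `sigF`, read over `sigF2`. -/
def liftTerm : {s : sigF.Sorts} → Term sigF s → Term sigF2 (0 : Fin 2)
  | _, .var _ n => Term.var (Sg := sigF2) (0 : Fin 2) n
  | _, .app _ args => Term.app (Sg := sigF2) () fun i => liftTerm (args i)

/-- A formula over `sigF`, read over `sigF2`. -/
def liftFormula : Formula sigF → Formula sigF2
  | .bot => .bot
  | .equal _ t t' => .equal (0 : Fin 2) (liftTerm t) (liftTerm t')
  | .rel P _ => P.elim
  | .neg φ => .neg (liftFormula φ)
  | .conj φ ψ => .conj (liftFormula φ) (liftFormula ψ)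
  | .disj φ ψ => .disj (liftFormula φ) (liftFormula ψ)
  | .all x φ => .all ((0 : Fin 2), x.2) (liftFormula φ)
  | .ex x φ => .ex ((0 : Fin 2), x.2) (liftFormula φ)

theorem vars_liftTerm {s : sigF.Sorts} (t : Term sigF s) :
    (liftTerm t).vars = (fun x : Var sigF => ((0 : Fin 2), x.2)) '' t.vars := by
  induction t with
  | var s n => simp [liftTerm, Term.vars]
  | app f args ih => simp only [liftTerm, Term.vars, ih, Set.image_iUnion]

theorem freeVars_liftFormula (φ : Formula sigF) :
    (liftFormula φ).freeVars = (fun x : Var sigF => ((0 : Fin 2), x.2)) '' φ.freeVars := by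
  have hinj : Function.Injective (fun x : Var sigF => ((0 : Fin 2), x.2)) := by
    rintro ⟨s, n⟩ ⟨s', n'⟩ h
    exact Prod.ext (Subsingleton.elim (α := Fin 1) s s') (Prod.ext_iff.1 h).2
  induction φ with
  | bot => simp [liftFormula, Formula.freeVars]
  | equal s t t' => simp only [liftFormula, Formula.freeVars, vars_liftTerm, Set.image_union]
  | rel P _ => exact P.elim
  | neg φ ih => exact ih
  | conj φ ψ ih ih' => simp only [liftFormula, Formula.freeVars, ih, ih', Set.image_union]
  | disj φ ψ ih ih' => simp only [liftFormula, Formula.freeVars, ih, ih', Set.image_union]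
  | all x φ ih =>
    simp only [liftFormula, Formula.freeVars, ih, Set.image_sdiff hinj, Set.image_singleton]
  | ex x φ ih =>
    simp only [liftFormula, Formula.freeVars, ih, Set.image_sdiff hinj, Set.image_singleton]

/-- The theory over `sigF2` with the same axioms as `T`. -/
def adds (T : Theory sigF) : Theory sigF2 where
  ax := liftFormula '' T.ax
  sentences := by
    rintro _ ⟨φ, hφ, rfl⟩
    rw [freeVars_liftFormula, T.sentences φ hφ, Set.image_empty]

/-- `S` is an undecidable set of primes that are at least `7`. -/
def UndecidablePrimes (S : Set ℕ) : Prop :=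
  (∀ n ∈ S, n.Prime ∧ 7 ≤ n) ∧ ¬ ComputablePred fun n : ℕ => n ∈ S

end ManySorted

open ManySorted ManySorted.Theory

namespace ManySorted

open Function

/-! ### Unary operations whose cycle lengths are restricted -/

/-! All eight theories only restrict which cycle lengths of a unary operation may occur together,
except that with the third kind of axiom a fixed point also forces the domain of `f` to be a
singleton. So every model condition is an instance of `CycleRestricted S b c`, where `b` switches on
the ban on 6-cycles and `c` the fixed-point axiom. `sigF` and `sigF2` are the cases `k = 0, 1` of
`sigFn k`, and a second sort carries no constraint, so everything is proved once for theories over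
`sigFn k` satisfying `ModelsAre`.

Strong witness. `flatWitness` gives a name to every value of a term of `φ`. From a model of the
witness and an arrangement, keep only the named elements. They are finitely many, and the operation
is known on those whose image is required to be named. `CycleRestricted.exists_completion` extends
this partial operation without leaving the class: either it already contains an infinite orbit, into
which all undefined points are sent, so that no cycle arises that was not a cycle of the original
model; or every orbit leaves its domain, and all orbits are directed into a single 2-cycle. A
2-cycle is always harmless when there is no cycle with length in `S`. No knowledge of `S` enters the
witness, which is why it is computable although `S` is not.

No computable minimal models. `separatingFormula k n` says that a nontrivial cycle of length
dividing `n` coexists with a solution of `f² (y) = y`, or that there is a cycle of length `2 ^ (n +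
1)`. For `n ≥ 7` outside `S`, an `n`-cycle and a 2-cycle give a model whose first domain has `n + 2`
elements. For `n ∈ S`, primality makes the first alternative contradict the axioms, and the second
needs more than `n + 2` elements. A list of minimal models would therefore decide `S`.

Stable infiniteness and convexity. Without `c`, a disjoint copy of the successor operation on `ℕ`
can be added, as it has no cycles; with `c`, the formula `f (x) = x` has only models with a
singleton first domain. Without `b`, models are closed under products, because `S` consists of
primes, and Horn-type reasoning gives convexity. With `b`, a point with `f⁶ (x) = x` has period 1, 2
or 3, so `f² (x) = x` or `f³ (x) = x`, yet neither alternative is forced. -/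

/-- Unary operations such that a cycle with length in `S` excludes solutions of `f² (y) = y`.
If `b`, there are no cycles of length `6`; if `c`, a fixed point is the only element. -/
structure CycleRestricted (S : Set ℕ) (b c : Prop) (X : Type u) (f : X → X) : Prop where
  not_two : ∀ n ∈ S, ∀ x y, minimalPeriod f x = n → f (f y) ≠ y
  not_six : b → ∀ x, minimalPeriod f x ≠ 6
  subsingleton : c → ∀ x, f x = x → ∀ y z : X, y = z

theorem minimalPeriod_eq_of_forall_dvd {X : Type*} {f : X → X} {x : X} {n : ℕ}
    (h : ∀ m, f^[m] x = x ↔ n ∣ m) : minimalPeriod f x = n :=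
  Nat.dvd_antisymm (IsPeriodicPt.minimalPeriod_dvd ((h n).2 dvd_rfl))
    ((h _).1 (iterate_minimalPeriod (f := f) (x := x)))

section CycleRestricted

variable {S : Set ℕ} {b c : Prop} {X : Type u} {Y : Type u} {f : X → X} {g : Y → Y}

/-- The first two conditions forbid combinations of cycle lengths, so they pass to any operation
that has no new lengths. The last one also speaks of the size of the domain, which `hc` takes care
of. -/
theorem CycleRestricted.transfer (hS : ∀ n ∈ S, n.Prime ∧ 7 ≤ n) (hf : CycleRestricted S b c X f)
    (hg : ∀ y ∈ periodicPts g, ∃ x, minimalPeriod f x = minimalPeriod g y)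
    (hc : c → Subsingleton X → Subsingleton Y) : CycleRestricted S b c Y g := by
  have aux : ∀ y n, 0 < n → minimalPeriod g y = n → ∃ x, minimalPeriod f x = n := by
    intro y n hn hy
    obtain ⟨x, hx⟩ := hg y (minimalPeriod_pos_iff_mem_periodicPts.1 (hy ▸ hn))
    exact ⟨x, hx.trans hy⟩
  refine ⟨?_, ?_, ?_⟩
  · intro n hn y z hy hz
    obtain ⟨x, hx⟩ := aux y n (by have := (hS n hn).2; omega) hy
    have hz' : IsPeriodicPt g 2 z := hz
    obtain ⟨w, hw⟩ := aux z _ (hz'.minimalPeriod_pos two_pos) rfl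
    have hw' : IsPeriodicPt f 2 w := by
      rw [isPeriodicPt_iff_minimalPeriod_dvd, hw]
      exact hz'.minimalPeriod_dvd
    exact hf.not_two n hn x w hx hw'
  · intro hb y hy
    obtain ⟨x, hx⟩ := aux y 6 (by omega) hy
    exact hf.not_six hb x hx
  · intro h y hy
    obtain ⟨x, hx⟩ := aux y 1 one_pos (minimalPeriod_eq_one_iff_isFixedPt.2 hy)
    have := hc h ⟨hf.subsingleton h x (minimalPeriod_eq_one_iff_isFixedPt.1 hx)⟩
    exact fun _ _ => Subsingleton.elim _ _

theorem cycleRestricted_of_subsingleton [Subsingleton Y] (hS : ∀ n ∈ S, n.Prime ∧ 7 ≤ n) :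
    CycleRestricted S b c Y g := by
  refine ⟨?_, ?_, fun _ _ _ _ _ => Subsingleton.elim _ _⟩
  · intro n hn x _ hx
    have := (hS n hn).2
    rw [minimalPeriod_eq_one_of_subsingleton] at hx
    omega
  · intro _ x hx
    rw [minimalPeriod_eq_one_of_subsingleton] at hx
    omega

/-- All three conditions become vacuous: their premises or their forbidden lengths mention only 1, 6
and elements of `S`. -/
theorem cycleRestricted_of_periods (hS : ∀ n ∈ S, n.Prime ∧ 7 ≤ n)
    (h : ∀ y ∈ periodicPts g, minimalPeriod g y ≠ 1 ∧ minimalPeriod g y ≠ 6 ∧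
      minimalPeriod g y ∉ S) : CycleRestricted S b c Y g := by
  have aux : ∀ y, 0 < minimalPeriod g y → minimalPeriod g y ≠ 1 ∧ minimalPeriod g y ≠ 6 ∧
      minimalPeriod g y ∉ S := fun y hy => h y (minimalPeriod_pos_iff_mem_periodicPts.1 hy)
  refine ⟨?_, ?_, ?_⟩
  · intro n hn x _ hx
    have := (hS n hn).2
    exact absurd (hx ▸ hn) (aux x (by omega)).2.2
  · intro _ x hx
    exact (aux x (by omega)).2.1 hx
  · intro _ x hx
    have hx : minimalPeriod g x = 1 := minimalPeriod_eq_one_iff_isFixedPt.2 hx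
    exact absurd hx (aux x (by omega)).1

/-- A partial operation on a finite set that extends to a restricted operation on a larger set can
be completed to a restricted operation. -/
theorem CycleRestricted.exists_completion (hS : ∀ n ∈ S, n.Prime ∧ 7 ≤ n)
    (hf : CycleRestricted S b c X f) [Finite Y] [Nonempty Y] (ι : Y → X) (hι : Injective ι)
    (p : Y → Y) (D : Set Y) (hp : ∀ y ∈ D, ι (p y) = f (ι y)) :
    ∃ g : Y → Y, (∀ y ∈ D, g y = p y) ∧ CycleRestricted S b c Y g := by
  classical
  have iter : ∀ (q : Y → Y), (∀ y ∈ D, q y = p y) → ∀ y, ∀ n, (∀ j < n, p^[j] y ∈ D) →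
      q^[n] y = p^[n] y := by
    intro q hq y n
    induction n with
    | zero => intro _; rfl
    | succ n ih =>
      intro h
      rw [iterate_succ_apply', iterate_succ_apply', ih fun j hj => h j (by omega),
        hq _ (h n (by omega))]
  -- Either some orbit of `p` stays in `D`, where `p` copies `f`, or every orbit of `p` leaves `D`.
  by_cases hA : ∃ d, ∀ j, p^[j] d ∈ D
  · obtain ⟨d₀, hd₀⟩ := hA
    obtain ⟨d, hd, hper⟩ : ∃ d, (∀ j, p^[j] d ∈ D) ∧ ∃ n, 0 < n ∧ p^[n] d = d := by
      obtain ⟨i, j, hij, h⟩ := Finite.exists_ne_map_eq_of_infinite fun i : ℕ => p^[i] d₀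
      wlog hlt : i < j generalizing i j
      · exact this j i hij.symm h.symm (by omega)
      refine ⟨p^[i] d₀, fun k => ?_, j - i, by omega, ?_⟩
      · rw [← iterate_add_apply]; exact hd₀ _
      · rw [← iterate_add_apply, show j - i + i = j by omega]; exact h.symm
    -- Redirecting every point outside `D` to `d` creates no cycle through such a point, since the
    -- orbit of `d` never leaves `D`.
    refine ⟨fun y => if y ∈ D then p y else d, fun y hy => if_pos hy, ?_⟩
    set g : Y → Y := fun y => if y ∈ D then p y else d with hg
    have hgD : ∀ y ∈ D, g y = p y := fun y hy => if_pos hy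
    have hgd : ∀ j, g^[j] d ∈ D := fun j => by
      rw [iter g hgD d j fun i _ => hd i]; exact hd j
    -- If a periodic orbit left `D` at time `j`, it would be at `d` at time `j + 1` and return to
    -- its position at time `j` after further full periods; that position would then lie in the
    -- orbit of `d`, hence in `D`.
    have stay : ∀ y ∈ periodicPts g, ∀ j, g^[j] y ∈ D := by
      rintro y ⟨n, hn, hy⟩ j
      by_contra hj
      have h1 : g^[j + 1] y = d := by rw [iterate_succ_apply']; exact if_neg hj
      have h2 : g^[j * n + n + j] y = g^[j] y := by
        rw [show j * n + n + j = j + (j + 1) * n by ring, iterate_add_apply]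
        congr 1
        exact hy.const_mul (j + 1)
      have h3 : j * n + n + j = (j * n + n - 1) + (j + 1) := by omega
      rw [h3, iterate_add_apply, h1] at h2
      exact hj (h2 ▸ hgd _)
    refine hf.transfer hS (fun y hy => ⟨ι y, ?_⟩) fun _ h => hι.subsingleton
    have key : ∀ n, f^[n] (ι y) = ι (g^[n] y) := by
      intro n
      induction n with
      | zero => rfl
      | succ n ih =>
        rw [iterate_succ_apply', iterate_succ_apply', ih, hgD _ (stay y hy n), hp _ (stay y hy n)]
    refine minimalPeriod_eq_of_forall_dvd fun m => ?_
    rw [key, hι.eq_iff, ← isPeriodicPt_iff_minimalPeriod_dvd]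
    rfl
  · push Not at hA
    rcases subsingleton_or_nontrivial Y with hY | hY
    · exact ⟨p, fun _ _ => rfl, cycleRestricted_of_subsingleton hS⟩
    have first : ∀ y, ∃ j, p^[j] y ∉ D ∧ ∀ i < j, p^[i] y ∈ D := fun y =>
      ⟨Nat.find (hA y), Nat.find_spec (hA y), fun i hi => not_not.1 (Nat.find_min (hA y) hi)⟩
    obtain ⟨e, he⟩ : ∃ e, e ∉ D := ⟨_, (hA (Classical.arbitrary Y)).choose_spec⟩
    -- The second point of the future 2-cycle. Follow the orbit of some `x ≠ e` until it leaves `D`: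
    -- if it leaves at `e`, the preceding point is already mapped to `e` by `p`; otherwise the exit
    -- point is free to be mapped there.
    obtain ⟨e', hne, he'⟩ : ∃ e', e' ≠ e ∧ (e' ∈ D → p e' = e) := by
      obtain ⟨x, hx⟩ := exists_ne e
      obtain ⟨j, hj, hlt⟩ := first x
      by_cases h : p^[j] x = e
      · cases j with
        | zero => exact absurd h hx
        | succ j =>
          refine ⟨p^[j] x, fun h' => he (h' ▸ hlt j (by omega)), fun _ => ?_⟩
          rwa [iterate_succ_apply'] at h
      · exact ⟨_, h, fun h' => absurd h' hj⟩
    -- Now `e` and `e'` form a 2-cycle and every other exit point goes to `e`. Hence every orbit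
    -- reaches `e`, and 2 is the only period.
    refine ⟨fun y => if y ∈ D then p y else if y = e then e' else e, fun y hy => if_pos hy, ?_⟩
    set g : Y → Y := fun y => if y ∈ D then p y else if y = e then e' else e with hg
    have hgD : ∀ y ∈ D, g y = p y := fun y hy => if_pos hy
    have hge : g e = e' := by simp [hg, he]
    have hge' : g e' = e := by
      by_cases h : e' ∈ D
      · simp [hg, h, he' h]
      · simp [hg, h, hne]
    have hreach : ∀ y, ∃ j, g^[j] y = e := by
      intro y
      obtain ⟨j, hj, hlt⟩ := first y
      have h := iter g hgD y j hlt
      by_cases hje : p^[j] y = e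
      · exact ⟨j, h.trans hje⟩
      · refine ⟨j + 1, ?_⟩
        rw [iterate_succ_apply', h]
        simp [hg, hj, hje]
    have he2 : minimalPeriod g e = 2 := by
      have : Fact (Nat.Prime 2) := ⟨Nat.prime_two⟩
      refine minimalPeriod_eq_prime ?_ ?_
      · change g (g e) = e
        rw [hge, hge']
      · intro h
        exact hne (hge.symm.trans h)
    refine cycleRestricted_of_periods hS fun y hy => ?_
    obtain ⟨j, hj⟩ := hreach y
    have : minimalPeriod g y = 2 := by rw [← minimalPeriod_apply_iterate hy j, hj, he2]
    rw [this]
    refine ⟨by omega, by omega, fun h => ?_⟩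
    have := (hS 2 h).2
    omega

/-- If a tuple has prime period `n ∈ S`, each coordinate has period 1 or `n`. A solution of `f² (y)
= y` in the product excludes `n` in every coordinate, so the tuple would be fixed. Length 6 behaves
differently: a 2-cycle and a 3-cycle multiply to a 6-cycle, which is why `b` must fail. -/
theorem CycleRestricted.pi (hS : ∀ n ∈ S, n.Prime ∧ 7 ≤ n) (hb : ¬ b) {I : Type} [Nonempty I]
    {X : I → Type u} {f : (i : I) → X i → X i} (hf : ∀ i, CycleRestricted S b c (X i) (f i)) :
    CycleRestricted S b c ((i : I) → X i) (fun x i => f i (x i)) := by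
  have iter : ∀ n (x : (i : I) → X i) (i : I),
      (fun (x : (i : I) → X i) i => f i (x i))^[n] x i = (f i)^[n] (x i) := by
    intro n
    induction n with
    | zero => intros; rfl
    | succ n ih => intro x i; rw [iterate_succ_apply, iterate_succ_apply, ih]
  refine ⟨?_, fun h => absurd h hb, ?_⟩
  · intro n hn x y hx hy
    have hfix : ∀ i, f i (x i) = x i := by
      intro i
      have h1 : IsPeriodicPt (f i) n (x i) := by
        change (f i)^[n] (x i) = x i
        rw [← iter, ← hx, iterate_minimalPeriod]
      rcases (Nat.dvd_prime (hS n hn).1).1 h1.minimalPeriod_dvd with h | h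
      · exact minimalPeriod_eq_one_iff_isFixedPt.1 h
      · exact absurd (congrFun hy i) ((hf i).not_two n hn _ (y i) h)
    have : minimalPeriod (fun (x : (i : I) → X i) i => f i (x i)) x = 1 :=
      minimalPeriod_eq_one_iff_isFixedPt.2 (funext hfix)
    have := (hS n hn).2
    omega
  · intro h x hx y z
    exact funext fun i => (hf i).subsingleton h (x i) (congrFun hx i) _ _

theorem minimalPeriod_sumMap_inl {X Y : Type*} (f : X → X) (g : Y → Y) (x : X) :
    minimalPeriod (Sum.map f g) (Sum.inl x) = minimalPeriod f x := by
  have iter : ∀ n, (Sum.map f g)^[n] (Sum.inl x) = Sum.inl (f^[n] x) := by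
    intro n
    induction n with
    | zero => rfl
    | succ n ih => rw [iterate_succ_apply', iterate_succ_apply', ih, Sum.map_inl]
  exact minimalPeriod_eq_of_forall_dvd fun m => by
    rw [iter, Sum.inl_injective.eq_iff, ← isPeriodicPt_iff_minimalPeriod_dvd]
    rfl

theorem minimalPeriod_sumMap_inr {X Y : Type*} (f : X → X) (g : Y → Y) (y : Y) :
    minimalPeriod (Sum.map f g) (Sum.inr y) = minimalPeriod g y := by
  have iter : ∀ n, (Sum.map f g)^[n] (Sum.inr y) = Sum.inr (g^[n] y) := by
    intro n
    induction n with
    | zero => rfl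
    | succ n ih => rw [iterate_succ_apply', iterate_succ_apply', ih, Sum.map_inr]
  exact minimalPeriod_eq_of_forall_dvd fun m => by
    rw [iter, Sum.inr_injective.eq_iff, ← isPeriodicPt_iff_minimalPeriod_dvd]
    rfl

/-- The successor operation has no periodic points, so the set of cycle lengths is unchanged. Under
`c` a one-point domain could not be enlarged in this way. -/
theorem CycleRestricted.sum_nat (hS : ∀ n ∈ S, n.Prime ∧ 7 ≤ n) (hc : ¬ c)
    (hf : CycleRestricted S b c X f) :
    CycleRestricted S b c (X ⊕ ULift.{u} ℕ) (Sum.map f fun n => ⟨n.down + 1⟩) := by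
  refine hf.transfer hS ?_ fun h => absurd h hc
  rintro (x | n) hy
  · exact ⟨x, (minimalPeriod_sumMap_inl _ _ _).symm⟩
  · exfalso
    have hpos := minimalPeriod_pos_iff_mem_periodicPts.2 hy
    rw [minimalPeriod_sumMap_inr] at hpos
    have h := iterate_minimalPeriod (f := fun n : ULift.{u} ℕ => (⟨n.down + 1⟩ : ULift ℕ)) (x := n)
    have iter : ∀ k, ((fun n : ULift.{u} ℕ => (⟨n.down + 1⟩ : ULift ℕ))^[k] n).down
        = n.down + k := by
      intro k
      induction k with
      | zero => rfl
      | succ k ih => rw [iterate_succ_apply', ih, Nat.add_assoc]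
    have h' := congrArg ULift.down h
    rw [iter] at h'
    omega

/-- Two disjoint cycles of lengths `m` and `n`. -/
def twoCycles (m n : ℕ) : ULift.{u} (ZMod m ⊕ ZMod n) → ULift.{u} (ZMod m ⊕ ZMod n) :=
  fun x => ⟨Sum.map (· + 1) (· + 1) x.down⟩

theorem minimalPeriod_zmod_add_one (m : ℕ) (x : ZMod m) : minimalPeriod (· + 1) x = m := by
  refine minimalPeriod_eq_of_forall_dvd fun k => ?_
  rw [add_right_iterate, nsmul_one, add_eq_left, ZMod.natCast_eq_zero_iff]

theorem minimalPeriod_uLift {X : Type*} (f : X → X) (x : X) :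
    minimalPeriod (fun y : ULift.{u} X => (⟨f y.down⟩ : ULift.{u} X)) ⟨x⟩ = minimalPeriod f x := by
  have iter : ∀ n, (fun y : ULift.{u} X => (⟨f y.down⟩ : ULift.{u} X))^[n] ⟨x⟩ = ⟨f^[n] x⟩ := by
    intro n
    induction n with
    | zero => rfl
    | succ n ih => rw [iterate_succ_apply', iterate_succ_apply', ih]
  exact minimalPeriod_eq_of_forall_dvd fun m => by
    rw [iter, ULift.up_injective.eq_iff, ← isPeriodicPt_iff_minimalPeriod_dvd]
    rfl

theorem minimalPeriod_twoCycles_inl (m n : ℕ) (x : ZMod m) :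
    minimalPeriod (twoCycles.{u} m n) ⟨Sum.inl x⟩ = m := 
  (minimalPeriod_uLift _ _).trans
    ((minimalPeriod_sumMap_inl _ _ _).trans (minimalPeriod_zmod_add_one _ x))

theorem minimalPeriod_twoCycles_inr (m n : ℕ) (x : ZMod n) :
    minimalPeriod (twoCycles.{u} m n) ⟨Sum.inr x⟩ = n := 
  (minimalPeriod_uLift _ _).trans
    ((minimalPeriod_sumMap_inr _ _ _).trans (minimalPeriod_zmod_add_one _ x))

theorem cycleRestricted_twoCycles (hS : ∀ n ∈ S, n.Prime ∧ 7 ≤ n) {m n : ℕ}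
    (hm : m ≠ 1 ∧ m ≠ 6 ∧ m ∉ S) (hn : n ≠ 1 ∧ n ≠ 6 ∧ n ∉ S) :
    CycleRestricted S b c _ (twoCycles.{u} m n) := by
  refine cycleRestricted_of_periods hS ?_
  rintro ⟨x | x⟩ -
  · rwa [minimalPeriod_twoCycles_inl]
  · rwa [minimalPeriod_twoCycles_inr]

end CycleRestricted

/-! ### Existence of an undecidable set of primes -/

/-- A computable set is determined by a program for its characteristic function, and there are
countably many programs. -/
theorem countable_setOf_computablePred : {S : Set ℕ | ComputablePred fun n => n ∈ S}.Countable := by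
  classical
  have h : ∀ S : {S : Set ℕ | ComputablePred fun n => n ∈ S}, ∃ c : Nat.Partrec.Code,
      ∀ n, c.eval n = Part.some (if n ∈ S.1 then 1 else 0) := by
    rintro ⟨S, hS⟩
    obtain ⟨D, hD⟩ := hS
    have h1 : Computable fun n : ℕ => if n ∈ S then 1 else 0 :=
      (Computable.cond hD (Computable.const 1) (Computable.const 0)).of_eq fun n => by
        by_cases hn : n ∈ S <;> simp [hn]
    obtain ⟨c, hc⟩ := Nat.Partrec.Code.exists_code.1 (Partrec.nat_iff.1 h1.partrec)
    exact ⟨c, fun n => by rw [hc, PFun.coe_val]; congr⟩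
  choose F hF using h
  refine Set.countable_coe_iff.1 (Injective.countable (f := F) fun S S' hSS' => ?_)
  refine Subtype.ext (Set.ext fun n => ?_)
  have := (hF S n).symm.trans ((congrArg (fun c => Nat.Partrec.Code.eval c n) hSS').trans (hF S' n))
  have := Part.some_injective this
  by_cases h1 : n ∈ S.1 <;> by_cases h2 : n ∈ S'.1 <;> simp_all

/-- By counting: infinitely many primes are at least 7, so uncountably many sets of them exist by
Cantor's theorem, too many for all to be decidable. -/
theorem exists_undecidablePrimes : ∃ S, UndecidablePrimes S := by
  by_contra! h
  have hinf : {p : ℕ | p.Prime ∧ 7 ≤ p}.Infinite := by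
    rw [Set.infinite_iff_exists_gt]
    intro a
    obtain ⟨p, hp, hp'⟩ := Nat.exists_infinite_primes (a + 7)
    exact ⟨p, ⟨hp', by omega⟩, by omega⟩
  have hc : (𝒫 {p : ℕ | p.Prime ∧ 7 ≤ p}).Countable := by
    refine countable_setOf_computablePred.mono fun S hS => ?_
    by_contra hS'
    exact h S ⟨fun n hn => hS hn, hS'⟩
  have := hinf.to_subtype
  let e : ℕ ≃ {p : ℕ | p.Prime ∧ 7 ≤ p} := (Nonempty.some (nonempty_equiv_of_countable))
  have hinj : Injective fun A : Set ℕ => (⟨(fun n => (e n : ℕ)) '' A, by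
      rintro _ ⟨n, -, rfl⟩; exact (e n).2⟩ : 𝒫 {p : ℕ | p.Prime ∧ 7 ≤ p}) := by
    intro A B hAB
    exact (Subtype.val_injective.comp e.injective).image_injective (congrArg Subtype.val hAB)
  have := hc.to_subtype
  have : Countable (Set ℕ) := hinj.countable
  obtain ⟨f, hf⟩ := exists_injective_nat (Set ℕ)
  exact cantor_injective f hf

/-! ### Satisfaction: general lemmas -/

section General

variable {Sg : Signature}

theorem Term.eval_congr (M : Struc.{u} Sg) {v w : (s : Sg.Sorts) → ℕ → M.dom s} {s : Sg.Sorts}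
    (t : Term Sg s) (h : ∀ x ∈ t.vars, v x.1 x.2 = w x.1 x.2) : t.eval M v = t.eval M w := by
  induction t with
  | var s n => exact h (s, n) rfl
  | app f args ih =>
    simp only [Term.eval]
    congr 1
    funext i
    exact ih i fun x hx => h x (Set.mem_iUnion.2 ⟨i, hx⟩)

theorem Formula.holds_congr (M : Struc.{u} Sg) {v w : (s : Sg.Sorts) → ℕ → M.dom s}
    (φ : Formula Sg) (hφ : φ.IsQF) (h : ∀ x ∈ φ.freeVars, v x.1 x.2 = w x.1 x.2) :
    φ.Holds M v ↔ φ.Holds M w := by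
  induction φ with
  | bot => rfl
  | equal s t t' =>
    simp only [Formula.Holds]
    rw [t.eval_congr M fun x hx => h x (.inl hx), t'.eval_congr M fun x hx => h x (.inr hx)]
  | rel P args =>
    simp only [Formula.Holds]
    rw [show (fun i => (args i).eval M v) = fun i => (args i).eval M w from
      funext fun i => (args i).eval_congr M fun x hx => h x (Set.mem_iUnion.2 ⟨i, hx⟩)]
  | neg φ ih => exact not_congr (ih hφ h)
  | conj φ ψ ih ih' =>
    exact and_congr (ih hφ.1 fun x hx => h x (.inl hx)) (ih' hφ.2 fun x hx => h x (.inr hx))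
  | disj φ ψ ih ih' =>
    exact or_congr (ih hφ.1 fun x hx => h x (.inl hx)) (ih' hφ.2 fun x hx => h x (.inr hx))
  | all => exact hφ.elim
  | ex => exact hφ.elim

theorem Term.eval_map {M M' : Struc.{u} Sg} (ι : (s : Sg.Sorts) → M.dom s → M'.dom s)
    (hfun : ∀ f args, ι _ (M.func f args) = M'.func f fun i => ι _ (args i))
    (v : (s : Sg.Sorts) → ℕ → M.dom s) {s : Sg.Sorts} (t : Term Sg s) :
    t.eval M' (fun s n => ι s (v s n)) = ι s (t.eval M v) := by
  induction t with
  | var s n => rfl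
  | app f args ih => simp only [Term.eval, hfun, ih]

theorem Formula.holds_map {M M' : Struc.{u} Sg} (ι : (s : Sg.Sorts) → M.dom s → M'.dom s)
    (hι : ∀ s, Injective (ι s))
    (hfun : ∀ f args, ι _ (M.func f args) = M'.func f fun i => ι _ (args i))
    (hrel : ∀ P args, M.pred P args ↔ M'.pred P fun i => ι _ (args i))
    (v : (s : Sg.Sorts) → ℕ → M.dom s) (φ : Formula Sg) (hφ : φ.IsQF) :
    φ.Holds M' (fun s n => ι s (v s n)) ↔ φ.Holds M v := by
  induction φ with
  | bot => rfl
  | equal s t t' => simp only [Formula.Holds, Term.eval_map ι hfun, (hι s).eq_iff]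
  | rel P args => simp only [Formula.Holds, Term.eval_map ι hfun, hrel]
  | neg φ ih => exact not_congr (ih hφ)
  | conj φ ψ ih ih' => exact and_congr (ih hφ.1) (ih' hφ.2)
  | disj φ ψ ih ih' => exact or_congr (ih hφ.1) (ih' hφ.2)
  | all => exact hφ.elim
  | ex => exact hφ.elim

theorem Formula.holds_bigConj {M : Struc.{u} Sg} {v : (s : Sg.Sorts) → ℕ → M.dom s}
    (l : List (Formula Sg)) : (bigConj l).Holds M v ↔ ∀ φ ∈ l, φ.Holds M v := by
  induction l with
  | nil => simp [bigConj, top, Holds]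
  | cons φ l ih => simp [bigConj, Holds, ih]

theorem Formula.holds_bigDisj {M : Struc.{u} Sg} {v : (s : Sg.Sorts) → ℕ → M.dom s}
    (l : List (Formula Sg)) : (bigDisj l).Holds M v ↔ ∃ φ ∈ l, φ.Holds M v := by
  induction l with
  | nil => simp [bigDisj, Holds]
  | cons φ l ih => simp [bigDisj, Holds, ih]

theorem Formula.holds_imp {M : Struc.{u} Sg} {v : (s : Sg.Sorts) → ℕ → M.dom s}
    (φ ψ : Formula Sg) : (φ.imp ψ).Holds M v ↔ (φ.Holds M v → ψ.Holds M v) := by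
  simp only [imp, Holds, imp_iff_not_or]

theorem Formula.mem_freeVars_bigConj (l : List (Formula Sg)) (x : Var Sg) :
    x ∈ (bigConj l).freeVars ↔ ∃ φ ∈ l, x ∈ φ.freeVars := by
  induction l with
  | nil => simp [bigConj, top, freeVars]
  | cons φ l ih => simp [bigConj, freeVars, ih]

theorem Formula.isQF_bigConj (l : List (Formula Sg)) (h : ∀ φ ∈ l, φ.IsQF) :
    (bigConj l).IsQF := by
  induction l with
  | nil => trivial
  | cons φ l ih =>
    simp only [List.mem_cons, forall_eq_or_imp] at h
    exact ⟨h.1, ih h.2⟩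

/-! ### Products and convexity -/

/-- The product of a family of structures. -/
def Struc.pi {I : Type} (M : I → Struc.{u} Sg) : Struc.{u} Sg where
  dom s := (i : I) → (M i).dom s
  nonempty_dom s := ⟨fun i => ((M i).nonempty_dom s).some⟩
  func f args := fun i => (M i).func f fun j => args j i
  pred P args := ∀ i, (M i).pred P fun j => args j i

theorem Term.eval_pi {I : Type} (M : I → Struc.{u} Sg)
    (v : (i : I) → (s : Sg.Sorts) → ℕ → (M i).dom s) {s : Sg.Sorts} (t : Term Sg s) :
    t.eval (Struc.pi M) (fun s n i => v i s n) = fun i => t.eval (M i) (v i) := by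
  induction t with
  | var s n => rfl
  | app f args ih =>
    funext i
    simp only [Term.eval, Struc.pi]
    congr 1
    funext j
    exact congrFun (ih j) i

theorem Formula.holds_pi_of_isAtomic {I : Type} (M : I → Struc.{u} Sg)
    (v : (i : I) → (s : Sg.Sorts) → ℕ → (M i).dom s) (φ : Formula Sg) (hφ : φ.IsAtomic) :
    φ.Holds (Struc.pi M) (fun s n i => v i s n) ↔ ∀ i, φ.Holds (M i) (v i) := by
  cases φ with
  | equal s t t' => simp only [Formula.Holds, Term.eval_pi]; exact funext_iff
  | rel P args => simp only [Formula.Holds, Term.eval_pi]; rfl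
  | bot => exact hφ.elim
  | neg => exact hφ.elim
  | conj => exact hφ.elim
  | disj => exact hφ.elim
  | all => exact hφ.elim
  | ex => exact hφ.elim

/-- An atomic formula holds in a product exactly if it holds in all factors; so a negated one holds
as soon as one factor refutes the atom, and this needs a factor to exist. -/
theorem Formula.holds_pi_of_isLiteral {I : Type} [Nonempty I] (M : I → Struc.{u} Sg)
    (v : (i : I) → (s : Sg.Sorts) → ℕ → (M i).dom s) (φ : Formula Sg) (hφ : φ.IsLiteral)
    (h : ∀ i, φ.Holds (M i) (v i)) : φ.Holds (Struc.pi M) (fun s n i => v i s n) := by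
  cases φ with
  | neg φ =>
    exact fun h' => h (Classical.arbitrary I) ((holds_pi_of_isAtomic M v φ hφ).1 h' _)
  | equal s t t' => exact (holds_pi_of_isAtomic M v (.equal s t t') trivial).2 h
  | rel P args => exact (holds_pi_of_isAtomic M v (.rel P args) trivial).2 h
  | bot => exact hφ.elim
  | conj => exact hφ.elim
  | disj => exact hφ.elim
  | all => exact hφ.elim
  | ex => exact hφ.elim

/-- A theory whose models are closed under finite non-empty products is convex. -/
theorem Theory.convex_of_pi (T : Theory Sg) (S : Set Sg.Sorts)
    (hT : ∀ (k : ℕ) [NeZero k] (A : Fin k → Interp.{u} Sg), (∀ i, T.IsInterp (A i)) →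
      T.IsInterp ⟨Struc.pi fun i => (A i).toStruc, fun s n i => (A i).val s n⟩) :
    Theory.Convex.{u} T S := by
  intro L hL k s x y hk _ hvalid
  by_contra! h
  have : NeZero k := ⟨hk.ne'⟩
  have h' : ∀ i, ∃ A : Interp.{u} Sg, T.IsInterp A ∧ (Formula.bigConj L).Holds A.toStruc A.val ∧
      A.val (s i) (x i) ≠ A.val (s i) (y i) := by
    intro i
    have hi := h i
    simp only [Theory.Valid, Interp.Sat, Formula.holds_imp, not_forall] at hi
    obtain ⟨A, hA, hA', hne⟩ := hi
    exact ⟨A, hA, hA', hne⟩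
  choose A hA hAL hAne using h'
  -- The product of one counterexample per equation satisfies the literals, while coordinate `i`
  -- refutes the `i`-th equation.
  have hmodel := hvalid _ (hT k A hA)
  rw [Interp.Sat, Formula.holds_imp, Formula.holds_bigDisj] at hmodel
  obtain ⟨φ, hφ, hholds⟩ := hmodel <| (Formula.holds_bigConj L).2 fun l hl =>
    Formula.holds_pi_of_isLiteral _ (fun i => (A i).val) l (hL l hl) fun i =>
      (Formula.holds_bigConj L).1 (hAL i) l hl
  obtain ⟨i, rfl⟩ := List.mem_ofFn.1 hφ
  exact hAne i (congrFun hholds i)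

/-! ### Arrangements -/

theorem holds_arrangement {M : Struc.{u} Sg} {v : (s : Sg.Sorts) → ℕ → M.dom s}
    (V : Finset (Var Sg)) (E : Setoid V) :
    (arrangement V E).Holds M v ↔ ∀ x y : V, x.1.1 = y.1.1 →
      (E x y ↔ v x.1.1 x.1.2 = v x.1.1 y.1.2) := by
  classical
  simp only [arrangement, Formula.holds_bigConj, List.forall_mem_map, Finset.mem_toList,
    Finset.mem_filter, Finset.mem_univ, true_and, Prod.forall]
  refine forall_congr' fun x => forall_congr' fun y => imp_congr_right fun _ => ?_
  split_ifs with h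
  · exact ⟨fun h' => ⟨fun _ => h', fun _ => h⟩, fun h' => h'.1 h⟩
  · exact ⟨fun h' => ⟨fun e => absurd e h, fun e => absurd e h'⟩, fun h' e => h (h'.2 e)⟩

theorem mem_freeVars_arrangement (V : Finset (Var Sg)) (E : Setoid V) {x : Var Sg}
    (hx : x ∈ V) : x ∈ (arrangement V E).freeVars := by
  classical
  rw [arrangement, Formula.mem_freeVars_bigConj]
  refine ⟨_, List.mem_map.2 ⟨(⟨x, hx⟩, ⟨x, hx⟩), by simp, rfl⟩, ?_⟩
  rw [if_pos (E.refl _)]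
  exact .inl rfl

end General

/-! ### Signatures with a unary function symbol and finitely many sorts -/

/-- Sorts `0`, ..., `k`, one function symbol of arity `0 → 0`, no predicate symbols. -/
@[reducible] def sigFn (k : ℕ) : Signature where
  Sorts := Fin (k + 1)
  Funcs := Unit
  Preds := Empty
  funcArity _ := 1
  funcDom _ _ := 0
  funcCod _ := 0
  predArity _ := 0
  predDom _ _ := 0
  nonempty_sorts := inferInstance
  encSorts := inferInstance
  encFuncs := inferInstance
  encPreds := inferInstance

section SigFn

variable {k : ℕ}

/-- The interpretation of the function symbol. -/
def Struc.op (M : Struc.{u} (sigFn k)) (a : M.dom (0 : Fin (k + 1))) : M.dom (0 : Fin (k + 1)) :=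
  M.func () fun _ => a

theorem Struc.func_eq_op (M : Struc.{u} (sigFn k)) (g : Unit)
    (args : Fin 1 → M.dom (0 : Fin (k + 1))) : M.func g args = M.op (args 0) := by
  rw [Struc.op]
  congr 1
  funext i
  rw [Subsingleton.elim i 0]

/-- The structure with given domains and a given operation on the domain of sort `0`. -/
def strucOf (dom : Fin (k + 1) → Type u) (hdom : ∀ s, Nonempty (dom s)) (f : dom 0 → dom 0) :
    Struc.{u} (sigFn k) where
  dom := dom
  nonempty_dom := hdom
  func _ args := f (args (0 : Fin 1))
  pred P := P.elim

/-- The models of `T` are the structures in which the operation is `CycleRestricted`. -/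
def Theory.ModelsAre (T : Theory (sigFn k)) (S : Set ℕ) (b c : Prop) : Prop :=
  ∀ A : Interp.{u} (sigFn k), T.IsInterp A ↔
    CycleRestricted S b c (A.dom (0 : Fin (k + 1))) A.toStruc.op

variable {T : Theory (sigFn k)} {S : Set ℕ} {b c : Prop}

/-! ### Stable infiniteness -/

theorem Theory.ModelsAre.stablyInfinite (hT : Theory.ModelsAre.{u} T S b c)
    (hS : ∀ n ∈ S, n.Prime ∧ 7 ≤ n) (hc : ¬ c) : Theory.StablyInfinite.{u} T Set.univ := by
  rintro φ ⟨A, hA, hφ⟩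
  let B : Struc.{u} (sigFn k) := strucOf (fun s => A.dom s ⊕ ULift.{u} ℕ) (fun _ => ⟨.inr ⟨0⟩⟩)
    (Sum.map A.toStruc.op fun n => ⟨n.down + 1⟩)
  refine ⟨⟨B, fun s n => Sum.inl (A.val s n)⟩, (hT _).2 (((hT A).1 hA).sum_nat hS hc), ?_, ?_⟩
  · refine (Formula.holds_map (M := A.toStruc) (M' := B) (fun _ => Sum.inl)
      (fun _ => Sum.inl_injective) ?_ (fun P => P.elim) A.val φ.1 φ.2).2 hφ
    intro f args
    rw [Struc.func_eq_op]
    rfl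
  · intro s _
    exact Cardinal.aleph0_le_mk (A.dom s ⊕ ULift.{u} ℕ)

/-- The term `f ^ n (x)`, where `x` is the variable of sort `0` with index `x`. -/
def iterTerm (k : ℕ) : ℕ → ℕ → Term (sigFn k) (0 : Fin (k + 1))
  | 0, x => Term.var (Sg := sigFn k) (0 : Fin (k + 1)) x
  | n + 1, x => Term.app (Sg := sigFn k) () fun _ => iterTerm k n x

theorem eval_iterTerm (M : Struc.{u} (sigFn k)) (v : (s : Fin (k + 1)) → ℕ → M.dom s) (n x : ℕ) :
    (iterTerm k n x).eval M v = M.op^[n] (v 0 x) := by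
  induction n with
  | zero => rfl
  | succ n ih => rw [iterate_succ_apply', ← ih]; rfl

/-- The formula `f ^ n (x) = y`. -/
def iterEq (k n x y : ℕ) : Formula (sigFn k) :=
  .equal (0 : Fin (k + 1)) (iterTerm k n x) (Term.var (Sg := sigFn k) (0 : Fin (k + 1)) y)

theorem holds_iterEq (M : Struc.{u} (sigFn k)) (v : (s : Fin (k + 1)) → ℕ → M.dom s)
    (n x y : ℕ) : (iterEq k n x y).Holds M v ↔ M.op^[n] (v 0 x) = v 0 y := by
  rw [← eval_iterTerm]
  rfl

/-- The interpretation in which all domains are `X`. -/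
def interpOf (k : ℕ) (X : Type u) (f : X → X) (v : ℕ → X) : Interp.{u} (sigFn k) where
  toStruc := strucOf (fun _ => X) (fun _ => ⟨v 0⟩) f
  val _ := v

theorem Theory.ModelsAre.not_stablyInfinite (hT : Theory.ModelsAre.{u} T S b c)
    (hS : ∀ n ∈ S, n.Prime ∧ 7 ≤ n) (hc : c) : ¬ Theory.StablyInfinite.{u} T Set.univ := by
  intro h
  -- The formula `f (x) = x` holds in a one-point model, and `c` leaves no larger first domain.
  obtain ⟨A, hA, hφ, hinf⟩ := h ⟨iterEq k 1 0 0, trivial⟩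
    ⟨interpOf k PUnit id fun _ => ⟨⟩,
      (hT _).2 (@cycleRestricted_of_subsingleton S b c PUnit _ inferInstance hS), rfl⟩
  have := ((hT A).1 hA).subsingleton hc (A.val (0 : Fin (k + 1)) 0) ((holds_iterEq _ _ _ _ _).1 hφ)
  have h1 : Cardinal.mk (A.dom (0 : Fin (k + 1))) ≤ 1 :=
    Cardinal.le_one_iff_subsingleton.2 ⟨this⟩
  exact absurd ((hinf (0 : Fin (k + 1)) trivial).trans h1) (not_le.2 Cardinal.one_lt_aleph0)

/-! ### Convexity -/

theorem Theory.ModelsAre.convex (hT : Theory.ModelsAre.{u} T S b c)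
    (hS : ∀ n ∈ S, n.Prime ∧ 7 ≤ n) (hb : ¬ b) : Theory.Convex.{u} T Set.univ :=
  Theory.convex_of_pi T _ fun _ _ A hA => (hT _).2 <|
    CycleRestricted.pi hS hb (X := fun i => (A i).dom (0 : Fin (k + 1)))
      (f := fun i => (A i).toStruc.op) fun i => (hT _).1 (hA i)

theorem Theory.ModelsAre.not_convex (hT : Theory.ModelsAre.{u} T S b c)
    (hS : ∀ n ∈ S, n.Prime ∧ 7 ≤ n) (hb : b) : ¬ Theory.Convex.{u} T Set.univ := by
  intro h
  have small : ∀ n, n < 7 → n ∉ S := fun n hn h => absurd (hS n h).2 (by omega)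
  -- Test models: variable `i` denotes the `i`-th iterate of a point on an `n`-cycle, so variables 0
  -- and `i` are equal iff `n ∣ i`. They are used with `n = 3` against `i = 2` and `n = 2` against
  -- `i = 3`.
  have hmodel : ∀ n, n ≠ 1 → n ≠ 6 → n < 7 → T.IsInterp (interpOf k _ (twoCycles.{u} n n)
      fun i => (twoCycles.{u} n n)^[i] ⟨.inl 0⟩) := fun n h1 h6 h7 =>
    (hT _).2 (cycleRestricted_twoCycles hS ⟨h1, h6, small n h7⟩ ⟨h1, h6, small n h7⟩)
  have key := h [iterEq k 6 0 0, iterEq k 2 0 2, iterEq k 3 0 3]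
    (by simp [iterEq, Formula.IsLiteral, Formula.IsAtomic]) 2 (fun _ => (0 : Fin (k + 1)))
    (fun _ => 0) ![2, 3] two_pos (fun _ => trivial) ?_
  · have hval : ∀ n i, n ≠ 1 → n ≠ 6 → n < 7 → n ∣ 6 → T.Valid ((Formula.bigConj
        [iterEq k 6 0 0, iterEq k 2 0 2, iterEq k 3 0 3]).imp
        (Formula.varEq (Sg := sigFn k) (0 : Fin (k + 1)) 0 i)) → n ∣ i := by
      intro n i h1 h6 h7 hdvd hvalid
      have := hvalid _ (hmodel n h1 h6 h7)
      have iter : ∀ j, (twoCycles.{u} n n)^[j] ⟨.inl 0⟩ = ⟨.inl 0⟩ ↔ n ∣ j := fun j => by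
        have := isPeriodicPt_iff_minimalPeriod_dvd (f := twoCycles.{u} n n) (x := ⟨.inl 0⟩) (n := j)
        rwa [minimalPeriod_twoCycles_inl] at this
      rw [Interp.Sat, Formula.holds_imp, Formula.holds_bigConj] at this
      refine (iter i).1 (this ?_).symm
      simp only [List.forall_mem_cons, holds_iterEq]
      exact ⟨(iter 6).2 hdvd, rfl, rfl, by simp⟩
    obtain ⟨i, hi⟩ := key
    fin_cases i
    · exact absurd (hval 3 2 (by omega) (by omega) (by omega) (by omega) hi) (by omega)
    · exact absurd (hval 2 3 (by omega) (by omega) (by omega) (by omega) hi) (by omega)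
  · intro A hA
    rw [Interp.Sat, Formula.holds_imp, Formula.holds_bigConj, Formula.holds_bigDisj]
    simp only [List.forall_mem_cons, holds_iterEq]
    rintro ⟨h6, h2, h3, -⟩
    simp only [List.mem_ofFn]
    have hdvd := IsPeriodicPt.minimalPeriod_dvd (show IsPeriodicPt _ 6 _ from h6)
    have hne := ((hT A).1 hA).not_six hb (A.val (0 : Fin (k + 1)) 0)
    have hle := Nat.le_of_dvd (by omega) hdvd
    have : ∀ i, minimalPeriod A.toStruc.op (A.val (0 : Fin (k + 1)) 0) ∣ i →
        A.toStruc.op^[i] (A.val (0 : Fin (k + 1)) 0) = A.val (0 : Fin (k + 1)) 0 := fun i hi =>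
      isPeriodicPt_iff_minimalPeriod_dvd.2 hi
    generalize minimalPeriod A.toStruc.op (A.val (0 : Fin (k + 1)) 0) = p at *
    have : p ∣ 2 ∨ p ∣ 3 := by interval_cases p <;> omega
    rcases this with hp | hp
    · exact ⟨_, ⟨0, rfl⟩, (this 2 hp).symm.trans h2⟩
    · exact ⟨_, ⟨1, rfl⟩, (this 3 hp).symm.trans h3⟩

end SigFn

/-! ### Bounded conjunctions and their Gödel numbers -/

/-- The conjunction of the formulas `F m` for `m < n`. -/
def Formula.conjUpTo {Sg : Signature} (F : ℕ → Formula Sg) : ℕ → Formula Sg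
  | 0 => top
  | n + 1 => conj (F n) (conjUpTo F n)

section ConjUpTo

variable {Sg : Signature} {F : ℕ → Formula Sg}

theorem Formula.holds_conjUpTo {M : Struc.{u} Sg} {v : (s : Sg.Sorts) → ℕ → M.dom s} (n : ℕ) :
    (conjUpTo F n).Holds M v ↔ ∀ m < n, (F m).Holds M v := by
  induction n with
  | zero => simp [conjUpTo, top, Holds]
  | succ n ih => simp only [conjUpTo, Holds, ih, Nat.forall_lt_succ_right, and_comm]

theorem Formula.mem_freeVars_conjUpTo (n : ℕ) {m : ℕ} (hm : m < n) {x : Var Sg}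
    (hx : x ∈ (F m).freeVars) : x ∈ (conjUpTo F n).freeVars := by
  induction n with
  | zero => omega
  | succ n ih =>
    rcases Nat.lt_succ_iff_lt_or_eq.1 hm with h | rfl
    · exact .inr (ih h)
    · exact .inl hx

theorem Formula.isQF_conjUpTo (hF : ∀ m, (F m).IsQF) (n : ℕ) : (conjUpTo F n).IsQF := by
  induction n with
  | zero => trivial
  | succ n ih => exact ⟨hF n, ih⟩

theorem Formula.primrec_code_conj {α : Type*} [Primcodable α] {F G : α → Formula Sg}
    (hF : Primrec fun a => (F a).code) (hG : Primrec fun a => (G a).code) :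
    Primrec fun a => ((F a).conj (G a)).code :=
  Primrec₂.natPair.comp (Primrec.const 4) (Primrec₂.natPair.comp hF hG)

theorem Formula.primrec_code_disj {α : Type*} [Primcodable α] {F G : α → Formula Sg}
    (hF : Primrec fun a => (F a).code) (hG : Primrec fun a => (G a).code) :
    Primrec fun a => ((F a).disj (G a)).code :=
  Primrec₂.natPair.comp (Primrec.const 5) (Primrec₂.natPair.comp hF hG)

theorem Formula.primrec_code_neg {α : Type*} [Primcodable α] {F : α → Formula Sg}
    (hF : Primrec fun a => (F a).code) : Primrec fun a => (F a).neg.code :=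
  Primrec₂.natPair.comp (Primrec.const 3) hF

/-- Needed because the length of the conjunctions in the witness varies with the input; the Gödel
number is built by primitive recursion on that length. -/
theorem Formula.primrec_code_conjUpTo {α : Type*} [Primcodable α] {F : α → ℕ → Formula Sg}
    (hF : Primrec₂ fun a n => (F a n).code) {l : α → ℕ} (hl : Primrec l) :
    Primrec fun a => (conjUpTo (F a) (l a)).code := by
  refine (Primrec.nat_rec' hl (Primrec.const (top : Formula Sg).code)
    (h := fun a p => Nat.pair 4 (Nat.pair (F a p.1).code p.2)) ?_).of_eq fun a => ?_
  · exact Primrec₂.natPair.comp (Primrec.const 4) (Primrec₂.natPair.comp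
      (hF.comp Primrec.fst (Primrec.fst.comp Primrec.snd)) (Primrec.snd.comp Primrec.snd))
  · induction l a with
    | zero => rfl
    | succ n ih => simp only [ih, conjUpTo, code]

theorem Formula.primrec_code_bigConj_map {α β : Type*} [Primcodable α] {F : α → β → Formula Sg}
    (hF : ∀ b, Primrec fun a => (F a b).code) (l : List β) :
    Primrec fun a => (bigConj (l.map (F a))).code := by
  induction l with
  | nil => exact Primrec.const _
  | cons b l ih => exact primrec_code_conj (hF b) ih

end ConjUpTo

section SigFn

variable {k : ℕ}

/-! ### Gödel numbers -/

theorem code_app (t : Term (sigFn k) (0 : Fin (k + 1))) :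
    (Term.app (Sg := sigFn k) () fun _ => t).code =
      Nat.pair 1 (Nat.pair ((sigFn k).funcCode ()) (Encodable.encode [t.code])) := rfl

theorem primrec_code_iterTerm {α : Type*} [Primcodable α] {n x : α → ℕ} (hn : Primrec n)
    (hx : Primrec x) : Primrec fun a => (iterTerm k (n a) (x a)).code := by
  refine (Primrec.nat_rec' hn
    (g := fun a => Nat.pair 0 (Nat.pair ((sigFn k).sortCode (0 : Fin (k + 1))) (x a)))
    (h := fun _ p =>
      Nat.pair 1 (Nat.pair ((sigFn k).funcCode ()) (Encodable.encode [p.2]))) ?_ ?_).of_eq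
    fun a => ?_
  · exact Primrec₂.natPair.comp (Primrec.const 0) (Primrec₂.natPair.comp (Primrec.const _) hx)
  · exact Primrec₂.natPair.comp (Primrec.const 1) (Primrec₂.natPair.comp (Primrec.const _)
      (Primrec.encode.comp (Primrec.list_cons.comp (Primrec.snd.comp Primrec.snd)
        (Primrec.const []))))
  · induction n a with
    | zero => rfl
    | succ n ih => simp only [ih, iterTerm, code_app]

theorem primrec_code_varEq {α : Type*} [Primcodable α] (s : Fin (k + 1)) {x y : α → ℕ}
    (hx : Primrec x) (hy : Primrec y) :
    Primrec fun a => (Formula.varEq (Sg := sigFn k) s (x a) (y a)).code :=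
  Primrec₂.natPair.comp (Primrec.const 1) (Primrec₂.natPair.comp (Primrec.const _)
    (Primrec₂.natPair.comp
      (Primrec₂.natPair.comp (Primrec.const 0) (Primrec₂.natPair.comp (Primrec.const _) hx))
      (Primrec₂.natPair.comp (Primrec.const 0) (Primrec₂.natPair.comp (Primrec.const _) hy))))

theorem primrec_code_iterEq {α : Type*} [Primcodable α] {n x y : α → ℕ} (hn : Primrec n)
    (hx : Primrec x) (hy : Primrec y) : Primrec fun a => (iterEq k (n a) (x a) (y a)).code :=
  Primrec₂.natPair.comp (Primrec.const 1) (Primrec₂.natPair.comp (Primrec.const _)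
    (Primrec₂.natPair.comp (primrec_code_iterTerm hn hx)
      (Primrec₂.natPair.comp (Primrec.const 0) (Primrec₂.natPair.comp (Primrec.const _) hy))))

theorem code_arg_lt (g : Unit) (args : Fin 1 → Term (sigFn k) (0 : Fin (k + 1))) (i : Fin 1) :
    (args i).code < (Term.app (Sg := sigFn k) g args).code := by
  rw [Subsingleton.elim i 0, show args = fun _ => args 0 from
    funext fun j => congrArg args (Subsingleton.elim j 0), code_app, Encodable.encode_list_cons]
  have h1 := Nat.left_le_pair (args 0).code (Encodable.encode ([] : List ℕ))
  have h2 := Nat.right_le_pair ((sigFn k).funcCode ())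
    (Nat.succ (Nat.pair (Encodable.encode (args 0).code) (Encodable.encode ([] : List ℕ))))
  have h3 := Nat.right_le_pair 1 (Nat.pair ((sigFn k).funcCode ())
    (Nat.succ (Nat.pair (Encodable.encode (args 0).code) (Encodable.encode ([] : List ℕ)))))
  simp only [Encodable.encode_nat] at h1 h2 h3 ⊢
  omega

theorem snd_le_code_of_mem_vars {s : (sigFn k).Sorts} (t : Term (sigFn k) s) :
    ∀ x ∈ t.vars, x.2 ≤ t.code := by
  induction t with
  | var s n =>
    rintro _ rfl
    exact (Nat.right_le_pair _ n).trans (Nat.right_le_pair 0 _)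
  | app f args ih =>
    intro x hx
    obtain ⟨i, hi⟩ := Set.mem_iUnion.1 hx
    exact (ih i x hi).trans (code_arg_lt f args i).le

theorem code_le_equal {Sg : Signature} (s : Sg.Sorts) (t t' : Term Sg s) :
    t.code ≤ (Formula.equal s t t').code ∧ t'.code ≤ (Formula.equal s t t').code := by
  have h : Nat.pair t.code t'.code ≤ (Formula.equal s t t').code :=
    (Nat.right_le_pair _ _).trans (Nat.right_le_pair _ _)
  exact ⟨(Nat.left_le_pair _ _).trans h, (Nat.right_le_pair _ _).trans h⟩

theorem code_le_conj {Sg : Signature} (φ ψ : Formula Sg) :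
    φ.code ≤ (φ.conj ψ).code ∧ ψ.code ≤ (φ.conj ψ).code :=
  ⟨(Nat.left_le_pair _ _).trans (Nat.right_le_pair _ _),
    (Nat.right_le_pair _ _).trans (Nat.right_le_pair _ _)⟩

theorem code_le_disj {Sg : Signature} (φ ψ : Formula Sg) :
    φ.code ≤ (φ.disj ψ).code ∧ ψ.code ≤ (φ.disj ψ).code :=
  ⟨(Nat.left_le_pair _ _).trans (Nat.right_le_pair _ _),
    (Nat.right_le_pair _ _).trans (Nat.right_le_pair _ _)⟩

theorem snd_le_code_of_mem_freeVars (φ : Formula (sigFn k)) (hφ : φ.IsQF) :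
    ∀ x ∈ φ.freeVars, x.2 ≤ φ.code := by
  induction φ with
  | bot => exact fun _ h => h.elim
  | equal s t t' =>
    rintro x (h | h)
    · exact (snd_le_code_of_mem_vars t x h).trans (code_le_equal s t t').1
    · exact (snd_le_code_of_mem_vars t' x h).trans (code_le_equal s t t').2
  | rel P => exact P.elim
  | neg φ ih => exact fun x h => (ih hφ x h).trans (Nat.right_le_pair _ _)
  | conj φ ψ ih ih' =>
    rintro x (h | h)
    · exact (ih hφ.1 x h).trans (code_le_conj φ ψ).1
    · exact (ih' hφ.2 x h).trans (code_le_conj φ ψ).2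
  | disj φ ψ ih ih' =>
    rintro x (h | h)
    · exact (ih hφ.1 x h).trans (code_le_disj φ ψ).1
    · exact (ih' hφ.2 x h).trans (code_le_disj φ ψ).2
  | all => exact hφ.elim
  | ex => exact hφ.elim

/-! ### Flattening -/

/-- The variables with indices below `N * N + N` list the iterates of the first `N` variables. -/
def Flat (N : ℕ) (M : Struc.{u} (sigFn k)) (v : (s : Fin (k + 1)) → ℕ → M.dom s) : Prop :=
  ∀ m < N * N, M.op (v 0 m) = v 0 (m + N)

/-- Variable `r + j * N` with `r < N` names the `j`-th iterate of variable `r`. Each application of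
`f` shifts the index by `N` and strictly increases the Gödel number, which therefore bounds both the
variable index and the depth of the term. The index `m` is chosen before the structure, so that two
structures can be compared. -/
theorem exists_eval_eq_of_flat (N : ℕ) {s : (sigFn k).Sorts} (t : Term (sigFn k) s)
    (ht : t.code < N) : ∃ m < N * (t.code + 1),
      ∀ (M : Struc.{u} (sigFn k)) (v : (s : Fin (k + 1)) → ℕ → M.dom s), Flat N M v →
        t.eval M v = v s m := by
  induction t with
  | var s n =>
    have h := snd_le_code_of_mem_vars (Term.var (Sg := sigFn k) s n) (s, n) rfl
    exact ⟨n, by simp only at h; nlinarith, fun _ _ _ => rfl⟩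
  | app f args ih =>
    have hlt := code_arg_lt f args 0
    obtain ⟨m, hm, h⟩ := ih (0 : Fin 1) (hlt.trans ht)
    set c' := (Term.app (Sg := sigFn k) f args).code
    set c := (args (0 : Fin 1)).code
    have hmN : m < N * N := hm.trans_le (Nat.mul_le_mul_left N (by omega))
    refine ⟨m + N, ?_, fun M v hv => ?_⟩
    · have : N * (c + 1) + N ≤ N * (c' + 1) := by
        rw [← Nat.mul_succ]; exact Nat.mul_le_mul_left N (by omega)
      omega
    · exact (Struc.func_eq_op M f _).trans ((congrArg M.op (h M v hv)).trans (hv m hmN))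

/-- Once every term is named by a variable, only the equalities between the named values matter. -/
theorem Formula.holds_iff_of_flat (N : ℕ) {M M' : Struc.{u} (sigFn k)}
    {v : (s : Fin (k + 1)) → ℕ → M.dom s} {v' : (s : Fin (k + 1)) → ℕ → M'.dom s}
    (hv : Flat N M v) (hv' : Flat N M' v')
    (h : ∀ s, ∀ m < N * N, ∀ m' < N * N, v s m = v s m' ↔ v' s m = v' s m')
    (φ : Formula (sigFn k)) (hφ : φ.IsQF) (hN : φ.code < N) : φ.Holds M v ↔ φ.Holds M' v' := by
  induction φ with
  | bot => rfl
  | equal s t t' =>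
    have hc := code_le_equal s t t'
    obtain ⟨m, hm, ht⟩ := exists_eval_eq_of_flat.{u} N t (hc.1.trans_lt hN)
    obtain ⟨m', hm', ht'⟩ := exists_eval_eq_of_flat.{u} N t' (hc.2.trans_lt hN)
    simp only [Formula.Holds, ht M v hv, ht' M v hv, ht M' v' hv', ht' M' v' hv']
    exact h s m (hm.trans_le (Nat.mul_le_mul_left N (by omega))) m'
      (hm'.trans_le (Nat.mul_le_mul_left N (by omega)))
  | rel P => exact P.elim
  | neg φ ih => exact not_congr (ih hφ ((Nat.right_le_pair _ _).trans_lt hN))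
  | conj φ ψ ih ih' =>
    exact and_congr (ih hφ.1 ((code_le_conj φ ψ).1.trans_lt hN))
      (ih' hφ.2 ((code_le_conj φ ψ).2.trans_lt hN))
  | disj φ ψ ih ih' =>
    exact or_congr (ih hφ.1 ((code_le_disj φ ψ).1.trans_lt hN))
      (ih' hφ.2 ((code_le_disj φ ψ).2.trans_lt hN))
  | all => exact hφ.elim
  | ex => exact hφ.elim

/-! ### The witness -/

/-- The equations that make an assignment `Flat`. -/
def flatFormula (k N : ℕ) : Formula (sigFn k) :=
  Formula.conjUpTo (fun m => iterEq k 1 m (m + N)) (N * N)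

/-- A valid formula that contains the first `n` variables of each sort. -/
def reflFormula (k n : ℕ) : Formula (sigFn k) :=
  Formula.bigConj ((List.finRange (k + 1)).map fun s =>
    Formula.conjUpTo (fun m => Formula.varEq (Sg := sigFn k) s m m) n)

theorem isQF_flatFormula (N : ℕ) : (flatFormula k N).IsQF :=
  Formula.isQF_conjUpTo (F := fun m => iterEq k 1 m (m + N)) (fun _ => trivial) _

theorem isQF_reflFormula (n : ℕ) : (reflFormula k n).IsQF :=
  Formula.isQF_bigConj _ <| List.forall_mem_map.2 fun s _ =>
    Formula.isQF_conjUpTo (F := fun m => Formula.varEq (Sg := sigFn k) s m m) (fun _ => trivial) _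

theorem holds_flatFormula {N : ℕ} {M : Struc.{u} (sigFn k)}
    {v : (s : Fin (k + 1)) → ℕ → M.dom s} : (flatFormula k N).Holds M v ↔ Flat N M v := by
  simp only [flatFormula, Formula.holds_conjUpTo, holds_iterEq]
  rfl

theorem holds_reflFormula (n : ℕ) (M : Struc.{u} (sigFn k))
    (v : (s : Fin (k + 1)) → ℕ → M.dom s) : (reflFormula k n).Holds M v := by
  simp only [reflFormula, Formula.holds_bigConj, List.forall_mem_map, Formula.holds_conjUpTo]
  intros
  rfl

theorem mem_freeVars_reflFormula (s : Fin (k + 1)) {m n : ℕ} (h : m < n) :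
    (s, m) ∈ (reflFormula k n).freeVars := by
  rw [reflFormula, Formula.mem_freeVars_bigConj]
  exact ⟨_, List.mem_map.2 ⟨s, List.mem_finRange s, rfl⟩,
    Formula.mem_freeVars_conjUpTo n h (.inl rfl)⟩

/-- The witness: all terms in the formula become equal to variables. -/
def flatWitness (k : ℕ) (φ : QF (sigFn k)) : QF (sigFn k) :=
  let N := φ.1.code + 1
  ⟨φ.1.conj ((flatFormula k N).conj (reflFormula k (N * N + N))), φ.2,
    isQF_flatFormula N, isQF_reflFormula _⟩

theorem computableOnQF_flatWitness : ComputableOnQF (flatWitness k) := by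
  have hN : Primrec fun c : ℕ => c + 1 := Primrec.succ
  have hNN : Primrec fun c : ℕ => (c + 1) * (c + 1) := Primrec.nat_mul.comp hN hN
  refine ⟨fun c => Nat.pair 4 (Nat.pair c (Nat.pair 4 (Nat.pair (flatFormula k (c + 1)).code
    (reflFormula k ((c + 1) * (c + 1) + (c + 1))).code))), ?_, fun φ => rfl⟩
  refine (Primrec₂.natPair.comp (Primrec.const 4) (Primrec₂.natPair.comp Primrec.id
    (Primrec₂.natPair.comp (Primrec.const 4) (Primrec₂.natPair.comp
      (Formula.primrec_code_conjUpTo ?_ hNN)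
      (Formula.primrec_code_bigConj_map (fun s => Formula.primrec_code_conjUpTo ?_
        (Primrec.nat_add.comp hNN hN)) _))))).to_comp
  · exact primrec_code_iterEq (Primrec.const 1) Primrec.snd
      (Primrec.nat_add.comp Primrec.snd (hN.comp Primrec.fst))
  · exact primrec_code_varEq s Primrec.snd Primrec.snd

variable {T : Theory (sigFn k)} {S : Set ℕ} {b c : Prop}

/-- The given model is cut down to the values of the variables in the witness and in `V`. The
flattening equations determine the operation on the first `N * N` variables, and
`CycleRestricted.exists_completion` defines it on the remaining elements. -/
theorem Theory.ModelsAre.exists_covered (hT : Theory.ModelsAre.{u} T S b c)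
    (hS : ∀ n ∈ S, n.Prime ∧ 7 ≤ n) (φ : QF (sigFn k)) (V : Finset (Var (sigFn k)))
    (E : Setoid V)
    (hsat : Theory.Satisfiable.{u} T ((flatWitness k φ).1.conj (arrangement V E))) :
    ∃ A : Interp.{u} (sigFn k), T.IsInterp A ∧
      A.Sat ((flatWitness k φ).1.conj (arrangement V E)) ∧ ∀ s, ∀ a : A.dom s, ∃ m,
        ((s, m) ∈ (flatWitness k φ).1.freeVars ∨ (s, m) ∈ V) ∧ A.val s m = a := by
  classical
  obtain ⟨A, hA, ⟨hφ, hflat, -⟩, harr⟩ := hsat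
  rw [holds_flatFormula] at hflat
  rw [holds_arrangement] at harr
  set N := φ.1.code + 1 with hN
  have hN0 : 0 < N := by omega
  let F : Fin (k + 1) → Set ℕ := fun s => {m | m < N * N + N ∨ (s, m) ∈ V}
  have hFfin : ∀ s, (F s).Finite := fun s =>
    (Set.finite_lt_nat _).union (V.finite_toSet.preimage (Prod.mk_right_injective s).injOn)
  have hF : ∀ s, ∀ m < N * N + N, m ∈ F s := fun s m hm => .inl hm
  let dom : Fin (k + 1) → Type u := fun s => A.val s '' F s
  -- Variables that are not listed may have values outside the new domains; they are reassigned to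
  -- the value of variable 0, which is always listed.
  let v : (s : Fin (k + 1)) → ℕ → dom s := fun s m =>
    if h : m ∈ F s then ⟨A.val s m, m, h, rfl⟩ else ⟨A.val s 0, 0, hF s 0 (by omega), rfl⟩
  have hv : ∀ s, ∀ m ∈ F s, (v s m : A.dom s) = A.val s m := fun s m hm => by
    simp only [v, dif_pos hm]
  have hveq : ∀ s, ∀ m ∈ F s, ∀ m' ∈ F s, A.val s m = A.val s m' ↔ v s m = v s m' :=
    fun s m hm m' hm' => by rw [← hv s m hm, ← hv s m' hm', Subtype.val_inj]
  have hdom : ∀ s, Nonempty (dom s) := fun s => ⟨v s 0⟩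
  have : Finite (dom 0) := (hFfin 0).image _
  -- Only the values on the first `N * N` variables matter, and there the first branch applies; the
  -- completion ignores `p` elsewhere.
  let p : dom 0 → dom 0 := fun y =>
    if h : A.toStruc.op y.1 ∈ A.val 0 '' F 0 then ⟨A.toStruc.op y.1, h⟩ else y
  obtain ⟨g, hg, hmod⟩ := ((hT A).1 hA).exists_completion hS (Y := dom 0) Subtype.val
    Subtype.val_injective p {y | ∃ m < N * N, v 0 m = y} (by
      rintro _ ⟨m, hm, rfl⟩
      have : A.toStruc.op (v 0 m).1 ∈ A.val 0 '' F 0 := by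
        rw [hv 0 m (hF 0 m (by omega)), hflat m hm]
        exact ⟨_, hF 0 _ (by omega), rfl⟩
      simp only [p, dif_pos this])
  have hgval : ∀ m < N * N, g (v 0 m) = v 0 (m + N) := by
    intro m hm
    have : A.toStruc.op (v 0 m).1 = v 0 (m + N) := by
      rw [hv 0 m (hF 0 m (by omega)), hv 0 _ (hF 0 _ (by omega)), hflat m hm]
    rw [hg _ ⟨m, hm, rfl⟩]
    refine Subtype.ext ?_
    simp only [p]
    rw [dif_pos (by rw [this]; exact (v 0 (m + N)).2)]
    exact this
  let B : Interp.{u} (sigFn k) := ⟨strucOf dom hdom g, v⟩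
  have hBflat : Flat N B.toStruc B.val := hgval
  refine ⟨B, (hT B).2 hmod, ⟨⟨?_, holds_flatFormula.2 hBflat, holds_reflFormula _ _ _⟩, ?_⟩, ?_⟩
  · exact (φ.1.holds_iff_of_flat N hflat hBflat (fun s m hm m' hm' =>
      hveq s m (hF s m (Nat.lt_add_right N hm)) m' (hF s m' (Nat.lt_add_right N hm'))) φ.2
      (Nat.lt_succ_self _)).1 hφ
  · rw [holds_arrangement]
    intro x y hxy
    rw [harr x y hxy]
    refine hveq x.1.1 _ (.inr x.2) _ (.inr ?_)
    rw [hxy]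
    exact y.2
  · rintro s ⟨_, m, hm, rfl⟩
    refine ⟨m, ?_, Subtype.ext (hv s m hm)⟩
    rcases hm with hm | hm
    · exact .inl (.inr (.inr (mem_freeVars_reflFormula s hm)))
    · exact .inr hm

theorem sat_iff_satEx_flatWitness (φ : QF (sigFn k)) (A : Interp.{u} (sigFn k)) :
    A.Sat φ.1 ↔ A.SatEx ((flatWitness k φ).1.freeVars \ φ.1.freeVars) (flatWitness k φ).1 := by
  constructor
  · intro hφ
    set N := φ.1.code + 1 with hN
    -- Variable `m = q * N + r` receives the `q`-th iterate of variable `r`. For `m < N` this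
    -- changes nothing, and all variables of `φ` have such indices.
    let w : (s : Fin (k + 1)) → ℕ → A.dom s := Function.update A.val (0 : Fin (k + 1)) fun m =>
      if m < N * N + N then A.toStruc.op^[m / N] (A.val (0 : Fin (k + 1)) (m % N))
      else A.val (0 : Fin (k + 1)) m
    have hw : ∀ m < N * N + N,
        w 0 m = A.toStruc.op^[m / N] (A.val (0 : Fin (k + 1)) (m % N)) := fun m hm => by
      simp only [w, Function.update_self, if_pos hm]
    have hwv : ∀ s n, (s, n) ∉ (flatWitness k φ).1.freeVars \ φ.1.freeVars →
        w s n = A.val s n := by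
      intro s n hsn
      by_cases hs : s = (0 : Fin (k + 1))
      · subst hs
        by_cases hn : n < N * N + N
        · have hmem : ((0 : Fin (k + 1)), n) ∈ φ.1.freeVars := by
            by_contra h
            exact hsn ⟨.inr (.inr (mem_freeVars_reflFormula _ hn)), h⟩
          have := snd_le_code_of_mem_freeVars φ.1 φ.2 _ hmem
          have hnN : n < N := by simp only at this; omega
          rw [hw n hn, Nat.div_eq_of_lt hnN, Nat.mod_eq_of_lt hnN]
          rfl
        · simp only [w, Function.update_self, if_neg hn]
      · simp only [w, Function.update_of_ne hs]
    refine ⟨w, hwv, ?_, holds_flatFormula.2 fun m hm => ?_, holds_reflFormula _ _ _⟩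
    · exact (φ.1.holds_congr A.toStruc φ.2 fun x hx => hwv x.1 x.2 fun h => h.2 hx).2 hφ
    · change m < N * N at hm
      rw [hw m (by omega), hw (m + N) (by omega), Nat.add_div_right m (by omega),
        Nat.add_mod_right, iterate_succ_apply']
  · rintro ⟨w, hw, hφ, -⟩
    exact (φ.1.holds_congr A.toStruc φ.2 fun x hx => hw x.1 x.2 fun h => h.2 hx).1 hφ

theorem Theory.ModelsAre.isStrongWitness (hT : Theory.ModelsAre.{u} T S b c)
    (hS : ∀ n ∈ S, n.Prime ∧ 7 ≤ n) :
    Theory.IsStrongWitness.{u} T Set.univ (flatWitness k) := by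
  refine ⟨⟨computableOnQF_flatWitness, fun φ A _ => sat_iff_satEx_flatWitness φ A, ?_⟩, ?_⟩
  · rintro φ ⟨A, hA, hsat⟩
    -- The plain witness property is the case of the empty arrangement.
    obtain ⟨B, hB, hBsat, hcov⟩ := hT.exists_covered hS φ ∅ ⊤
      ⟨A, hA, hsat, (holds_arrangement _ _).2 fun x => absurd x.2 (Finset.notMem_empty _)⟩
    refine ⟨B, hB, hBsat.1.1, fun s _ => (Set.eq_univ_of_forall fun a => ?_).symm⟩
    obtain ⟨m, hm | hm, rfl⟩ := hcov s a
    · exact ⟨m, hm, rfl⟩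
    · exact absurd hm (Finset.notMem_empty _)
  · intro φ V E _ _ hsat
    obtain ⟨B, hB, hBsat, hcov⟩ := hT.exists_covered hS φ V E hsat
    refine ⟨B, hB, hBsat, fun s _ => (Set.eq_univ_of_forall fun a => ?_).symm⟩
    obtain ⟨m, hm | hm, rfl⟩ := hcov s a
    · exact ⟨m, .inl hm, rfl⟩
    · exact ⟨m, .inr (mem_freeVars_arrangement V E hm), rfl⟩

end SigFn

/-! ### Minimal model functions are not computable -/

section SigFn

variable {k : ℕ}

theorem cast_minimalPeriod_le_mk {X : Type u} [Nonempty X] (f : X → X) (x : X) :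
    (minimalPeriod f x : Cardinal.{u}) ≤ Cardinal.mk X := by
  by_contra! h
  have : Finite X := Cardinal.lt_aleph0_iff_finite.1 (h.trans (Cardinal.natCast_lt_aleph0))
  have := Fintype.ofFinite X
  rw [Cardinal.mk_fintype, Nat.cast_lt] at h
  exact absurd minimalPeriod_le_card (not_le.2 h)

/-- There are a cycle whose length divides `n` and is not `1` and a solution of `f² (y) = y`,
or there is a cycle of length `2 ^ (n + 1)`. -/
def separatingFormula (k n : ℕ) : Formula (sigFn k) :=
  ((iterEq k n 0 0).conj ((iterEq k 1 0 0).neg.conj (iterEq k 2 1 1))).disj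
    ((iterEq k (2 ^ (n + 1)) 0 0).conj (iterEq k (2 ^ n) 0 0).neg)

theorem primrec_code_separatingFormula : Primrec fun n => (separatingFormula k n).code := by
  have hc : ∀ m : ℕ, Primrec fun _ : ℕ => m := fun m => Primrec.const m
  have hpow : Primrec fun n : ℕ => 2 ^ n :=
    Primrec₂.comp (Primrec₂.unpaired'.1 Nat.Primrec.pow) (hc 2) Primrec.id
  exact Formula.primrec_code_disj
    (Formula.primrec_code_conj (primrec_code_iterEq Primrec.id (hc 0) (hc 0))
      (Formula.primrec_code_conj
        (Formula.primrec_code_neg (primrec_code_iterEq (hc 1) (hc 0) (hc 0)))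
        (primrec_code_iterEq (hc 2) (hc 1) (hc 1))))
    (Formula.primrec_code_conj
      (primrec_code_iterEq (hpow.comp Primrec.succ) (hc 0) (hc 0))
      (Formula.primrec_code_neg (primrec_code_iterEq hpow (hc 0) (hc 0))))

theorem holds_separatingFormula (n : ℕ) (M : Struc.{u} (sigFn k))
    (v : (s : Fin (k + 1)) → ℕ → M.dom s) :
    (separatingFormula k n).Holds M v ↔
      (M.op^[n] (v 0 0) = v 0 0 ∧ ¬ M.op (v 0 0) = v 0 0 ∧ M.op (M.op (v 0 1)) = v 0 1) ∨
      (M.op^[2 ^ (n + 1)] (v 0 0) = v 0 0 ∧ ¬ M.op^[2 ^ n] (v 0 0) = v 0 0) := by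
  simp only [separatingFormula, Formula.Holds, holds_iterEq]
  rfl

variable {T : Theory (sigFn k)} {S : Set ℕ} {b c : Prop}

/-- The model is a disjoint union of an `n`-cycle and a 2-cycle. The bound `7 ≤ n` keeps `n` away
from the lengths 1 and 6. -/
theorem Theory.ModelsAre.exists_separating (hT : Theory.ModelsAre.{u} T S b c)
    (hS : ∀ n ∈ S, n.Prime ∧ 7 ≤ n) {n : ℕ} (hn : 7 ≤ n) (hnS : n ∉ S) :
    ∃ A : Interp.{u} (sigFn k), T.IsInterp A ∧ A.Sat (separatingFormula k n) ∧
      Cardinal.mk (A.dom (0 : Fin (k + 1))) = (n + 2 : ℕ) := by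
  have : NeZero n := ⟨by omega⟩
  have h2 : 2 ∉ S := fun h => absurd (hS 2 h).2 (by omega)
  refine ⟨interpOf k _ (twoCycles.{u} n 2) fun i => if i = 0 then ⟨.inl 0⟩ else ⟨.inr 0⟩,
    (hT _).2 (cycleRestricted_twoCycles hS ⟨by omega, by omega, hnS⟩
      ⟨by omega, by omega, h2⟩), ?_, ?_⟩
  · rw [Interp.Sat, holds_separatingFormula]
    refine .inl ⟨?_, fun h => ?_, ?_⟩
    · have := iterate_minimalPeriod (f := twoCycles.{u} n 2) (x := ⟨.inl 0⟩)
      rwa [minimalPeriod_twoCycles_inl] at this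
    · have := minimalPeriod_eq_one_iff_isFixedPt (f := twoCycles.{u} n 2) (x := ⟨.inl 0⟩).2 h
      rw [minimalPeriod_twoCycles_inl] at this
      omega
    · have := iterate_minimalPeriod (f := twoCycles.{u} n 2) (x := ⟨.inr 0⟩)
      rwa [minimalPeriod_twoCycles_inr] at this
  · change Cardinal.mk (ULift.{u} (ZMod n ⊕ ZMod 2)) = _
    rw [Cardinal.mk_uLift, Cardinal.mk_fintype, Fintype.card_sum, ZMod.card, ZMod.card,
      Cardinal.lift_natCast]

/-- A minimal model function is unconstrained on unsatisfiable formulas, so the second disjunct has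
to provide a model for every `n`. The length `2 ^ (n + 1)` is never 1 or 6, and never a prime that
is at least 7. -/
theorem Theory.ModelsAre.satisfiable_separatingFormula (hT : Theory.ModelsAre.{u} T S b c)
    (hS : ∀ n ∈ S, n.Prime ∧ 7 ≤ n) (n : ℕ) :
    Theory.Satisfiable.{u} T (separatingFormula k n) := by
  have h1 : 2 ≤ 2 ^ (n + 1) := by
    rw [pow_succ]
    have := Nat.one_le_two_pow (n := n)
    omega
  have h6 : 2 ^ (n + 1) ≠ 6 := by
    rw [pow_succ]
    rcases n with _ | _ | n
    · omega
    · omega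
    · rw [pow_succ, pow_succ]
      omega
  have hmem : 2 ^ (n + 1) ∉ S := by
    intro h
    have h7 := (hS _ h).2
    have := ((Nat.prime_dvd_prime_iff_eq Nat.prime_two (hS _ h).1).1
      (dvd_pow_self 2 (Nat.succ_ne_zero n)))
    omega
  refine ⟨interpOf k _ (twoCycles.{u} (2 ^ (n + 1)) (2 ^ (n + 1))) fun _ => ⟨.inl 0⟩,
    (hT _).2 (cycleRestricted_twoCycles hS ⟨by omega, h6, hmem⟩ ⟨by omega, h6, hmem⟩), ?_⟩
  rw [Interp.Sat, holds_separatingFormula]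
  have iter : ∀ j, (twoCycles.{u} (2 ^ (n + 1)) (2 ^ (n + 1)))^[j] ⟨.inl 0⟩ = ⟨.inl 0⟩ ↔
      2 ^ (n + 1) ∣ j := fun j => by
    have := isPeriodicPt_iff_minimalPeriod_dvd
      (f := twoCycles.{u} (2 ^ (n + 1)) (2 ^ (n + 1))) (x := ⟨.inl 0⟩) (n := j)
    rwa [minimalPeriod_twoCycles_inl] at this
  refine .inr ⟨(iter _).2 dvd_rfl, fun h => ?_⟩
  have := Nat.le_of_dvd (by positivity) ((iter _).1 h)
  rw [pow_succ] at this
  have := Nat.one_le_two_pow (n := n)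
  omega

/-- As `n` is prime, the first disjunct would give a cycle of length exactly `n` next to a solution
of `f² (y) = y`, against the axioms. The second gives a point of period `2 ^ (n + 1) > n + 2`. -/
theorem Theory.ModelsAre.lt_mk_of_sat_separatingFormula (hT : Theory.ModelsAre.{u} T S b c)
    (hS : ∀ n ∈ S, n.Prime ∧ 7 ≤ n) {n : ℕ} (hn : n ∈ S) (A : Interp.{u} (sigFn k))
    (hA : T.IsInterp A) (hsat : A.Sat (separatingFormula k n)) :
    ((n + 2 : ℕ) : Cardinal.{u}) < Cardinal.mk (A.dom (0 : Fin (k + 1))) := by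
  have h7 := (hS n hn).2
  have : Fact n.Prime := ⟨(hS n hn).1⟩
  rw [Interp.Sat, holds_separatingFormula] at hsat
  rcases hsat with ⟨hn', h1, h2⟩ | ⟨h1, h2⟩
  · exact absurd h2 (((hT A).1 hA).not_two n hn _ _ (minimalPeriod_eq_prime hn' h1))
  · have : Fact (Nat.Prime 2) := ⟨Nat.prime_two⟩
    have hp := minimalPeriod_eq_prime_pow h2 h1
    have : Nonempty (A.dom (0 : Fin (k + 1))) := A.nonempty_dom _
    refine lt_of_lt_of_le ?_ (cast_minimalPeriod_le_mk A.toStruc.op (A.val (0 : Fin (k + 1)) 0))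
    rw [hp, Nat.cast_lt, pow_succ]
    have := Nat.lt_two_pow_self (n := n)
    omega

/-- The decision procedure: `n ∈ S` iff `7 ≤ n` and every listed minimal model of `separatingFormula
k n` has more than `n + 2` elements in sort `0`. -/
theorem Theory.ModelsAre.not_hasComputableMinimalModelFunction
    (hT : Theory.ModelsAre.{u} T S b c) (hS : UndecidablePrimes S) :
    ¬ Theory.HasComputableMinimalModelFunction.{u} T Set.univ := by
  rintro ⟨MM, hMM, g, hg, hgMM⟩
  refine hS.2 ?_
  let s : Fin (k + 1) := 0
  let i := (sigFn k).sortCode s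
  -- The entry `none` stands for `ℵ₀`; replacing it by `n + 3` makes it pass the test.
  have hlarge : PrimrecRel fun (l : List (Option ℕ)) (n : ℕ) =>
      n + 2 < (l.getD i none).getD (n + 3) :=
    Primrec.nat_lt.comp (Primrec.nat_add.comp Primrec.snd (Primrec.const 2))
      (Primrec.option_getD.comp
        ((Primrec.list_getD none).comp Primrec.fst (Primrec.const i))
        (Primrec.nat_add.comp Primrec.snd (Primrec.const 3)))
  have hdec : PrimrecPred fun p : List (List (Option ℕ)) × ℕ =>
      7 ≤ p.2 ∧ ∀ l ∈ p.1, p.2 + 2 < (l.getD i none).getD (p.2 + 3) :=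
    (Primrec.nat_le.comp (Primrec.const 7) Primrec.snd).and hlarge.forall_mem_list
  refine ComputablePred.computable_of_manyOneReducible
    ⟨fun n => (g (separatingFormula k n).code, n), ?_, fun n => ?_⟩ hdec.computablePred
  · exact (hg.comp primrec_code_separatingFormula.to_comp).pair Computable.id
  let φ : QF (sigFn k) := ⟨separatingFormula k n, by
    simp [separatingFormula, Formula.IsQF, iterEq]⟩
  obtain ⟨hreal, -, hmin⟩ := hMM φ (hT.satisfiable_separatingFormula hS.1 n)
  constructor
  · intro hn
    refine ⟨(hS.1 n hn).2, fun l hl => ?_⟩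
    obtain ⟨A, hA, hsat, hcard⟩ := hreal (cardFunOf Set.univ l) (by
      rw [hgMM φ]; exact ⟨l, hl, rfl⟩)
    have h1 := hT.lt_mk_of_sat_separatingFormula hS.1 hn A hA hsat
    have h2 : cardOf (l.getD i none) = Cardinal.mk (A.dom s) := hcard ⟨s, trivial⟩
    change _ < Cardinal.mk (A.dom s) at h1
    rw [← h2] at h1
    dsimp only
    cases h : l.getD i none with
    | none => simp
    | some m =>
      rw [h] at h1
      exact Nat.cast_lt.1 h1
  · rintro ⟨h7, hl⟩
    by_contra hn
    obtain ⟨A, hA, hsat, hcard⟩ := hT.exists_separating hS.1 h7 hn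
    obtain ⟨c, hc, hle⟩ := hmin A hA hsat
    rw [hgMM φ] at hc
    obtain ⟨l, hlmem, rfl⟩ := hc
    have h1 := hl l hlmem
    have h2 : cardOf (l.getD i none) ≤ Cardinal.mk (A.dom s) := hle ⟨s, trivial⟩
    change Cardinal.mk (A.dom s) = _ at hcard
    rw [hcard] at h2
    dsimp only at h1
    cases h : l.getD i none with
    | none =>
      rw [h] at h2
      exact absurd h2 (not_le.2 (Cardinal.natCast_lt_aleph0))
    | some m =>
      rw [h] at h1 h2
      simp only [cardOf, Nat.cast_le] at h2
      simp only [Option.getD_some] at h1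
      omega

/-- The properties of a theory whose models are the structures with restricted cycles. -/
theorem Theory.ModelsAre.properties (hT : Theory.ModelsAre.{u} T S b c)
    (hS : UndecidablePrimes S) :
    Theory.IsUnicorn2.{u} T Set.univ ∧ (Theory.StablyInfinite.{u} T Set.univ ↔ ¬ c) ∧
      (Theory.Convex.{u} T Set.univ ↔ ¬ b) :=
  ⟨⟨⟨_, hT.isStrongWitness hS.1⟩, hT.not_hasComputableMinimalModelFunction hS⟩,
    ⟨fun h hc => hT.not_stablyInfinite hS.1 hc h, hT.stablyInfinite hS.1⟩,
    ⟨fun h hb => hT.not_convex hS.1 hb h, hT.convex hS.1⟩⟩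

end SigFn

/-! ### The eight theories -/

/-- Here `sigF` is identified with `sigFn 0`, to which it unfolds; this lets the general results
apply to `T1`, ..., `T4`. -/
theorem eval_fpow (M : Struc.{u} (sigFn 0)) (v : (s : Fin 1) → ℕ → M.dom s) (n x : ℕ) :
    Term.eval (Sg := sigF) M v (fpow n x) = M.op^[n] (v 0 x) := by
  induction n with
  | zero => rfl
  | succ n ih => rw [iterate_succ_apply', ← ih]; rfl

theorem holds_fpowEq (M : Struc.{u} (sigFn 0)) (v : (s : Fin 1) → ℕ → M.dom s) (n x : ℕ) :
    Formula.Holds (Sg := sigF) M (fpowEq n x) v ↔ M.op^[n] (v 0 x) = v 0 x := by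
  rw [← eval_fpow]
  rfl

/-- Proper divisors suffice because the minimal period of a point with `f^[n] x = x` divides `n`. -/
theorem minimalPeriod_eq_iff_of_pos {X : Type*} {f : X → X} {x : X} {n : ℕ} (hn : 0 < n) :
    minimalPeriod f x = n ↔ f^[n] x = x ∧ ∀ m < n, m ∣ n → f^[m] x ≠ x := by
  constructor
  · rintro rfl
    refine ⟨iterate_minimalPeriod, fun m hm hdvd h => ?_⟩
    exact not_isPeriodicPt_of_pos_of_lt_minimalPeriod (Nat.pos_of_dvd_of_pos hdvd hn).ne' hm h
  · rintro ⟨h, hne⟩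
    have hdvd := IsPeriodicPt.minimalPeriod_dvd (show IsPeriodicPt f n x from h)
    by_contra hlt
    exact hne _ (lt_of_le_of_ne (Nat.le_of_dvd hn hdvd) hlt) hdvd iterate_minimalPeriod

theorem holds_cycle (M : Struc.{u} (sigFn 0)) (v : (s : Fin 1) → ℕ → M.dom s) {n : ℕ}
    (hn : 0 < n) (x : ℕ) :
    Formula.Holds (Sg := sigF) M (cycle n x) v ↔ minimalPeriod M.op (v 0 x) = n := by
  rw [minimalPeriod_eq_iff_of_pos hn, cycle]
  refine and_congr (holds_fpowEq M v n x) ?_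
  rw [Formula.holds_bigConj]
  simp only [List.forall_mem_map, List.mem_filter, List.mem_range, decide_eq_true_eq, and_imp]
  exact forall₃_congr fun m _ _ => not_congr (holds_fpowEq M v m x)

theorem exists_holds_iff (M : Struc.{u} (sigFn 0)) (v : (s : Fin 1) → ℕ → M.dom s) (n : ℕ)
    {φ : Formula sigF} {p : M.dom (0 : Fin 1) → Prop}
    (h : ∀ w, Formula.Holds (Sg := sigF) M φ w ↔ p (w 0 n)) :
    Formula.Holds (Sg := sigF) M (.ex ((0 : Fin 1), n) φ) v ↔ ∃ a, p a := by
  constructor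
  · rintro ⟨w, -, hw⟩
    exact ⟨_, (h w).1 hw⟩
  · rintro ⟨a, ha⟩
    refine ⟨update v (0 : Fin 1) (update (v 0) n a), fun s m hm => ?_, (h _).2 (by simpa)⟩
    obtain rfl : s = (0 : Fin 1) := Subsingleton.elim (α := Fin 1) _ _
    rw [update_self, update_of_ne fun h => hm (by rw [h])]

theorem forall_holds_iff (M : Struc.{u} (sigFn 0)) (v : (s : Fin 1) → ℕ → M.dom s) (n : ℕ)
    {φ : Formula sigF} {p : M.dom (0 : Fin 1) → Prop}
    (h : ∀ w, Formula.Holds (Sg := sigF) M φ w ↔ p (w 0 n)) :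
    Formula.Holds (Sg := sigF) M (.all ((0 : Fin 1), n) φ) v ↔ ∀ a, p a := by
  have := not_congr (exists_holds_iff M v n (φ := .neg φ) (p := fun a => ¬ p a)
    fun w => not_congr (h w))
  simp only [not_exists, not_not] at this
  rw [← this]
  simp only [Formula.Holds, not_exists, not_and, not_not]

theorem holds_forall_forall_varEq (M : Struc.{u} (sigFn 0)) (v : (s : Fin 1) → ℕ → M.dom s) :
    Formula.Holds (Sg := sigF) M (.all ((0 : Fin 1), 0) (.all ((0 : Fin 1), 1)
      (Formula.varEq (0 : Fin 1) 0 1))) v ↔ ∀ a b : M.dom (0 : Fin 1), a = b := by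
  constructor
  · intro h a b
    have := h (update v (0 : Fin 1) (update (v 0) 0 a)) (fun s m hm => by
        obtain rfl : s = (0 : Fin 1) := Subsingleton.elim (α := Fin 1) _ _
        rw [update_self, update_of_ne fun h => hm (by rw [h])])
      (update v (0 : Fin 1) (update (update (v 0) 0 a) 1 b)) (fun s m hm => by
        obtain rfl : s = (0 : Fin 1) := Subsingleton.elim (α := Fin 1) _ _
        rw [update_self, update_self, update_of_ne fun h => hm (by rw [h])])
    simpa [Formula.varEq, Formula.Holds, Term.eval] using this
  · intro h w _ w' _
    exact h _ _

theorem sat_ax1_iff {S : Set ℕ} (hS : ∀ n ∈ S, n.Prime ∧ 7 ≤ n) (A : Interp.{u} (sigFn 0)) :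
    (∀ φ ∈ ax1 S, Interp.Sat (Sg := sigF) A φ) ↔
      ∀ n ∈ S, ∀ x y, minimalPeriod A.toStruc.op x = n → A.toStruc.op (A.toStruc.op y) ≠ y := by
  have key : ∀ n ∈ S, Interp.Sat (Sg := sigF) A
      ((Formula.ex (Sg := sigF) ((0 : Fin 1), 0) (cycle n 0)).imp
        (.all ((0 : Fin 1), 0) (fpowEq 2 0).neg)) ↔
      ((∃ x, minimalPeriod A.toStruc.op x = n) → ∀ y, A.toStruc.op (A.toStruc.op y) ≠ y) := by
    intro n hn
    have hpos : 0 < n := (hS n hn).1.pos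
    rw [Interp.Sat, Formula.holds_imp]
    refine imp_congr ?_ ?_
    · exact exists_holds_iff _ _ _ fun w => holds_cycle A.toStruc w hpos 0
    · exact forall_holds_iff _ _ _ (p := fun y => A.toStruc.op (A.toStruc.op y) ≠ y)
        fun w => not_congr (holds_fpowEq A.toStruc w 2 0)
  constructor
  · intro h n hn x y hx
    exact (key n hn).1 (h _ ⟨n, hn, rfl⟩) ⟨x, hx⟩ y
  · rintro h _ ⟨n, hn, rfl⟩
    exact (key n hn).2 fun ⟨x, hx⟩ y => h n hn x y hx

theorem sat_not_cycle_six_iff (A : Interp.{u} (sigFn 0)) :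
    Interp.Sat (Sg := sigF) A (Formula.ex (Sg := sigF) ((0 : Fin 1), 0) (cycle 6 0)).neg ↔
      ∀ x, minimalPeriod A.toStruc.op x ≠ 6 := by
  rw [← not_exists]
  exact not_congr (exists_holds_iff _ _ _ fun w => holds_cycle A.toStruc w (by omega) 0)

theorem sat_subsingleton_iff (A : Interp.{u} (sigFn 0)) :
    Interp.Sat (Sg := sigF) A ((Formula.ex (Sg := sigF) ((0 : Fin 1), 0) (fpowEq 1 0)).imp
      (.all ((0 : Fin 1), 0) (.all ((0 : Fin 1), 1) (Formula.varEq (0 : Fin 1) 0 1)))) ↔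
      ∀ x, A.toStruc.op x = x → ∀ y z : A.dom (0 : Fin 1), y = z := by
  rw [Interp.Sat, Formula.holds_imp]
  refine Iff.trans ?_ (⟨fun h x hx => h ⟨x, hx⟩, fun h ⟨x, hx⟩ => h x hx⟩ :
    ((∃ x, A.toStruc.op x = x) → ∀ y z : A.dom (0 : Fin 1), y = z) ↔ _)
  exact imp_congr (exists_holds_iff _ _ _ fun w => holds_fpowEq A.toStruc w 1 0)
    (holds_forall_forall_varEq _ _)

section Theories

variable {S : Set ℕ}

theorem modelsAre_T1 (hS : ∀ n ∈ S, n.Prime ∧ 7 ≤ n) :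
    Theory.ModelsAre.{u} (k := 0) (T1 S) S False False := fun A =>
  (sat_ax1_iff hS A).trans
    ⟨fun h => ⟨h, False.elim, False.elim⟩, fun h => h.not_two⟩

theorem modelsAre_T2 (hS : ∀ n ∈ S, n.Prime ∧ 7 ≤ n) :
    Theory.ModelsAre.{u} (k := 0) (T2 S) S True False := by
  intro A
  constructor
  · intro h
    exact ⟨(sat_ax1_iff hS A).1 fun φ hφ => h φ (.inl hφ),
      fun _ => (sat_not_cycle_six_iff A).1 (h _ (.inr rfl)), False.elim⟩
  · rintro h φ (hφ | rfl)
    · exact (sat_ax1_iff hS A).2 h.not_two φ hφ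
    · exact (sat_not_cycle_six_iff A).2 (h.not_six trivial)

theorem modelsAre_T3 (hS : ∀ n ∈ S, n.Prime ∧ 7 ≤ n) :
    Theory.ModelsAre.{u} (k := 0) (T3 S) S False True := by
  intro A
  constructor
  · intro h
    exact ⟨(sat_ax1_iff hS A).1 fun φ hφ => h φ (.inl hφ), False.elim,
      fun _ => (sat_subsingleton_iff A).1 (h _ (.inr rfl))⟩
  · rintro h φ (hφ | rfl)
    · exact (sat_ax1_iff hS A).2 h.not_two φ hφ
    · exact (sat_subsingleton_iff A).2 (h.subsingleton trivial)

theorem modelsAre_T4 (hS : ∀ n ∈ S, n.Prime ∧ 7 ≤ n) :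
    Theory.ModelsAre.{u} (k := 0) (T4 S) S True True := by
  intro A
  constructor
  · intro h
    have h2 := (modelsAre_T2 hS A).1 fun φ hφ => h φ (.inl hφ)
    have h3 := (modelsAre_T3 hS A).1 fun φ hφ => h φ (.inr hφ)
    exact ⟨h2.not_two, h2.not_six, h3.subsingleton⟩
  · rintro h φ (hφ | hφ)
    · exact (modelsAre_T2 hS A).2 ⟨h.not_two, h.not_six, False.elim⟩ φ hφ
    · exact (modelsAre_T3 hS A).2 ⟨h.not_two, False.elim, h.subsingleton⟩ φ hφ

end Theories

/-! ### Passage to two sorts -/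

/-- The reduct to the first sort. -/
def Struc.reduct (M : Struc.{u} (sigFn 1)) : Struc.{u} (sigFn 0) :=
  strucOf (fun _ => M.dom (0 : Fin 2)) (fun _ => M.nonempty_dom (0 : Fin 2)) M.op

theorem eval_liftTerm (M : Struc.{u} (sigFn 1)) (v : (s : Fin 2) → ℕ → M.dom s)
    {s : sigF.Sorts} (t : Term sigF s) :
    Term.eval (Sg := sigF2) M v (liftTerm t) =
      Term.eval (Sg := sigF) M.reduct (fun _ => v 0) t := by
  induction t with
  | var s n => rfl
  | app f args ih =>
    refine (Struc.func_eq_op M () _).trans ?_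
    exact congrArg M.op (ih (0 : Fin 1))

/-- Changing one variable of sort `0` amounts to the same over either signature, as `p` does not see
the values of sort `1`. -/
theorem forall_reduct_iff (M : Struc.{u} (sigFn 1)) (v : (s : Fin 2) → ℕ → M.dom s)
    (x : Var sigF) (p : (ℕ → M.dom (0 : Fin 2)) → Prop) :
    (∀ w : (s : Fin 2) → ℕ → M.dom s, (∀ s n, (s, n) ≠ ((0 : Fin 2), x.2) → w s n = v s n) →
        p (w 0)) ↔
      ∀ w : Fin 1 → ℕ → M.dom (0 : Fin 2), (∀ s n, (s, n) ≠ x → w s n = v 0 n) → p (w 0) := by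
  have hx : x = ((0 : Fin 1), x.2) := Prod.ext (Subsingleton.elim (α := Fin 1) _ _) rfl
  constructor
  · intro h w hw
    have := h (update v (0 : Fin 2) (w 0)) fun s n hsn => by
      by_cases hs : s = 0
      · subst hs
        rw [update_self]
        refine hw 0 n fun h' => hsn ?_
        rw [← h']
      · rw [update_of_ne hs]
    rwa [update_self] at this
  · intro h w hw
    refine h (fun _ => w 0) fun s n hsn => hw 0 n fun h' => hsn ?_
    rw [hx]
    exact Prod.ext (Subsingleton.elim (α := Fin 1) _ _) (Prod.ext_iff.1 h').2

theorem holds_liftFormula (M : Struc.{u} (sigFn 1)) (φ : Formula sigF) :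
    ∀ v : (s : Fin 2) → ℕ → M.dom s, Formula.Holds (Sg := sigF2) M (liftFormula φ) v ↔
      Formula.Holds (Sg := sigF) M.reduct φ (fun _ => v 0) := by
  have hall : ∀ (x : Var sigF) (φ : Formula sigF),
      (∀ v : (s : Fin 2) → ℕ → M.dom s, Formula.Holds (Sg := sigF2) M (liftFormula φ) v ↔
        Formula.Holds (Sg := sigF) M.reduct φ (fun _ => v 0)) →
      ∀ v : (s : Fin 2) → ℕ → M.dom s,
        Formula.Holds (Sg := sigF2) M (liftFormula (.all x φ)) v ↔
        Formula.Holds (Sg := sigF) M.reduct (.all x φ) (fun _ => v 0) := by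
    intro x φ ih v
    have := forall_reduct_iff M v x fun w =>
      Formula.Holds (Sg := sigF) M.reduct φ (fun _ => w)
    have hconst : ∀ w : Fin 1 → ℕ → M.dom (0 : Fin 2), (fun _ => w 0) = w := fun w =>
      funext fun s => congrArg w (Subsingleton.elim _ _)
    simp only [hconst] at this
    refine Iff.trans ?_ this
    exact forall₂_congr fun w _ => ih w
  induction φ with
  | bot => exact fun _ => Iff.rfl
  | equal s t t' =>
    intro v
    simp only [liftFormula, Formula.Holds, eval_liftTerm]
    rfl
  | rel P => exact P.elim
  | neg φ ih => exact fun v => not_congr (ih v)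
  | conj φ ψ ih ih' => exact fun v => and_congr (ih v) (ih' v)
  | disj φ ψ ih ih' => exact fun v => or_congr (ih v) (ih' v)
  | all x φ ih => exact hall x φ ih
  | ex x φ ih =>
    intro v
    have := not_congr (hall x φ.neg (fun v => not_congr (ih v)) v)
    simpa only [liftFormula, Formula.Holds, not_forall, not_not, exists_prop] using this

/-- The axioms speak only of the reduct to sort `0`, so the second domain is unconstrained. -/
theorem Theory.ModelsAre.adds {S : Set ℕ} {b c : Prop} {T : Theory sigF}
    (hT : Theory.ModelsAre.{u} (k := 0) T S b c) :
    Theory.ModelsAre.{u} (k := 1) (adds T) S b c := by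
  intro A
  refine Iff.trans ?_ (hT ⟨A.toStruc.reduct, fun _ => A.val (0 : Fin 2)⟩)
  refine Set.forall_mem_image.trans (forall₂_congr fun φ _ => ?_)
  exact holds_liftFormula A.toStruc φ A.val

end ManySorted

/-! ### The main theorem -/

theorem mainTheorem4 :
    (∃ S : Set ℕ, UndecidablePrimes S) ∧
    (∀ S : Set ℕ, UndecidablePrimes S →
      (IsUnicorn2.{u} (T1 S) Set.univ ∧
        StablyInfinite.{u} (T1 S) Set.univ ∧ Theory.Convex.{u} (T1 S) Set.univ) ∧
      (IsUnicorn2.{u} (T2 S) Set.univ ∧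
        StablyInfinite.{u} (T2 S) Set.univ ∧ ¬ Theory.Convex.{u} (T2 S) Set.univ) ∧
      (IsUnicorn2.{u} (T3 S) Set.univ ∧
        ¬ StablyInfinite.{u} (T3 S) Set.univ ∧ Theory.Convex.{u} (T3 S) Set.univ) ∧
      (IsUnicorn2.{u} (T4 S) Set.univ ∧
        ¬ StablyInfinite.{u} (T4 S) Set.univ ∧ ¬ Theory.Convex.{u} (T4 S) Set.univ) ∧
      (IsUnicorn2.{u} (adds (T1 S)) Set.univ ∧
        StablyInfinite.{u} (adds (T1 S)) Set.univ ∧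
        Theory.Convex.{u} (adds (T1 S)) Set.univ) ∧
      (IsUnicorn2.{u} (adds (T2 S)) Set.univ ∧
        StablyInfinite.{u} (adds (T2 S)) Set.univ ∧
        ¬ Theory.Convex.{u} (adds (T2 S)) Set.univ) ∧
      (IsUnicorn2.{u} (adds (T3 S)) Set.univ ∧
        ¬ StablyInfinite.{u} (adds (T3 S)) Set.univ ∧
        Theory.Convex.{u} (adds (T3 S)) Set.univ) ∧
      (IsUnicorn2.{u} (adds (T4 S)) Set.univ ∧
        ¬ StablyInfinite.{u} (adds (T4 S)) Set.univ ∧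
        ¬ Theory.Convex.{u} (adds (T4 S)) Set.univ)) ∧
    (∀ oneSorted stablyInf convex : Prop, ∃ (Sg : Signature) (T : Theory Sg),
      Finite Sg.Sorts ∧ Finite Sg.Funcs ∧ Finite Sg.Preds ∧
      (Nonempty Sg.Funcs ∨ Nonempty Sg.Preds) ∧
      IsUnicorn2.{u} T Set.univ ∧
      (Nat.card Sg.Sorts = 1 ↔ oneSorted) ∧
      (StablyInfinite.{u} T Set.univ ↔ stablyInf) ∧
      (Theory.Convex.{u} T Set.univ ↔ convex)) := by
  have pick : ∀ {X Y Z b c : Prop}, X ∧ (Y ↔ ¬ c) ∧ (Z ↔ ¬ b) →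
      (¬ c → ¬ b → X ∧ Y ∧ Z) ∧ (¬ c → b → X ∧ Y ∧ ¬ Z) ∧ (c → ¬ b → X ∧ ¬ Y ∧ Z) ∧
        (c → b → X ∧ ¬ Y ∧ ¬ Z) := by tauto
  refine ⟨exists_undecidablePrimes, fun S hS => ?_, fun oneSorted stablyInf convex => ?_⟩
  · have h1 := modelsAre_T1.{u} hS.1
    have h2 := modelsAre_T2.{u} hS.1
    have h3 := modelsAre_T3.{u} hS.1
    have h4 := modelsAre_T4.{u} hS.1
    exact ⟨(pick (h1.properties hS)).1 id id, (pick (h2.properties hS)).2.1 id trivial,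
      (pick (h3.properties hS)).2.2.1 trivial id,
      (pick (h4.properties hS)).2.2.2 trivial trivial,
      (pick (h1.adds.properties hS)).1 id id, (pick (h2.adds.properties hS)).2.1 id trivial,
      (pick (h3.adds.properties hS)).2.2.1 trivial id,
      (pick (h4.adds.properties hS)).2.2.2 trivial trivial⟩
  · obtain ⟨S, hS⟩ := exists_undecidablePrimes
    -- The pair (stably infinite, convex) selects one of the four theories; the number of sorts then
    -- decides between it and its two-sorted version.
    obtain ⟨T, b, c, hT, hb, hc⟩ : ∃ (T : Theory sigF) (b c : Prop),
        Theory.ModelsAre.{u} (k := 0) T S b c ∧ (¬ c ↔ stablyInf) ∧ (¬ b ↔ convex) := by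
      by_cases hs : stablyInf <;> by_cases hc : convex
      · exact ⟨_, _, _, modelsAre_T1 hS.1, by tauto, by tauto⟩
      · exact ⟨_, _, _, modelsAre_T2 hS.1, by tauto, by tauto⟩
      · exact ⟨_, _, _, modelsAre_T3 hS.1, by tauto, by tauto⟩
      · exact ⟨_, _, _, modelsAre_T4 hS.1, by tauto, by tauto⟩
    by_cases ho : oneSorted
    · obtain ⟨hU, hSI, hC⟩ := hT.properties hS
      exact ⟨sigF, T, inferInstanceAs (Finite (Fin 1)), inferInstanceAs (Finite Unit),
        inferInstanceAs (Finite Empty), .inl ⟨()⟩, hU,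
        by simpa using ho, hSI.trans hb, hC.trans hc⟩
    · obtain ⟨hU, hSI, hC⟩ := hT.adds.properties hS
      exact ⟨sigF2, adds T, inferInstanceAs (Finite (Fin 2)), inferInstanceAs (Finite Unit),
        inferInstanceAs (Finite Empty), .inl ⟨()⟩, hU,
        by simpa using ho, hSI.trans hb, hC.trans hc⟩
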